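/- **Setting.** Let $d\ge 1$, $T>0$, $\mathfrak g\in\mathbb R$, $\mathfrak s\ge 0$. The interface is $\Sigma_t=\{(x,\eta(t,x)):x\in\mathbb R^d\}$; each rigid boundary $\Gamma^\pm$ is either empty (infinite depth) or the graph of a Lipschitz function $\underline b^\pm:\mathbb R^d\to\mathbb R$; the fluid domains are $\Omega^-_t=\{\underline b^-(x)<y<\eta(t,x)\}$ and $\Omega^+_t=\{\eta(t,x)<y<\underline b^+(x)\}$ (with the condition on $\underline b^\pm$ omitted if $\Gamma^\pm=\emptyset$). For a.e. $t\in(0,T)$ the function $\eta(t)$ is Lipschitz and $\Sigma_t$ has positive distance to the rigid boundaries present: $\eta(t)\ge \underline b^-+h$, resp. $\eta(t)\le\underline b^+-h$, for some $h>0$. Let $n=(1+|\nabla\eta|^2)^{-1/2}(-\nabla\eta,1)$ be the upward unit normal of $\Sigma_t$, $\nu^\pm$ the outward unit normal of $\Gamma^\pm$, and $H(\eta)=-\mathrm{div}\big(\nabla\eta/\sqrt{1+|\nabla\eta|^2}\big)$. Equations are understood in the weak sense, in the finite-energy class, for a.e. $t\in(0,T)$: $\partial_t\eta$ is a locally integrable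 weak derivative; velocities are in $L^2(\Omega_t^\pm)$ (this expresses the vanishing at infinity), pressures are $H^1$ on the bounded parts of $\Omega^\pm_t$; boundary values are traces; the condition $w\cdot\nu^\pm=0$ on $\Gamma^\pm$ for divergence-free $w\in L^2(\Omega^\pm)$ means $\int_{\Omega^\pm}w\cdot\nabla v=0$ for all $v\in\dot H^1(\Omega^\pm)$ with $v|_\Sigma=0$; the normal trace $\sqrt{1+|\nabla\eta|^2}\,w\cdot n|_\Sigma$ of such $w$ is the distribution defined by Green's formula. **Dirichlet–Neumann operators.** Let $f$ be the trace on $\Sigma$ of a function in $\dot H^1(\Omega^\pm)$, and let $\phi^\pm\in\dot H^1(\Omega^\pm)$ be the variational solution of $\Delta_{x,y}\phi^\pm=0$ in $\Omega^\pm$, $\phi^\pm=f$ on $\Sigma$, $\partial_{\nu^\pm}\phi^\pm=0$ on $\Gamma^\pm$. Then $G^\pm(\eta)f=\sqrt{1+|\nabla\eta|^2}\,\partial_n\phi^\pm|_\Sigma$. **Muskat problems.** Let $\mu^\pm>0$ and $\rho^\pm\in\mathbb R$. The two-phase Muskat problem for $(u^\pm,p^\pm,\eta)$ is $$\mu^\pm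 u^\pm+\nabla_{x,y}p^\pm=-\rho^\pm\mathfrak g\,\vec e_{d+1},\quad \mathrm{div}_{x,y}u^\pm=0\ \text{ in }\Omega^\pm_t,\qquad u^\pm\cdot\nu^\pm=0\ \text{ on }\Gamma^\pm,$$ $$u^+\cdot n=u^-\cdot n,\qquad \partial_t\eta=\sqrt{1+|\nabla\eta|^2}\,u^-\cdot n,\qquad p^--p^+=\mathfrak sH(\eta)\quad\text{ on }\Sigma_t .$$ The one-phase Muskat problem for $(u,p,\eta)=(u^-,p^-,\eta)$ consists of the equations in $\Omega^-_t$ and on $\Gamma^-$, together with $\partial_t\eta=\sqrt{1+|\nabla\eta|^2}\,u^-\cdot n$ and $p^-=\mathfrak sH(\eta)$ on $\Sigma_t$. **Proposition.** (i) If $(u,p,\eta)$ solves the one-phase Muskat problem on $(0,T)$, then $$\partial_t\eta=-\frac1{\mu^-}G^-(\eta)\big(\mathfrak sH(\eta)+\rho^-\mathfrak g\eta\big),\tag{1}$$ where in particular $\mathfrak sH(\eta)+\rho^-\mathfrak g\eta$ is a function in the domain of $G^-(\eta)$. Conversely, if $\eta$ solves (1), then there are $u,p$ such that $(u,p,\eta)$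 solves the one-phase Muskat problem. (ii) If $(u^\pm,p^\pm,\eta)$ solves the two-phase Muskat problem on $(0,T)$, then $f^\pm:=p^\pm|_\Sigma+\rho^\pm\mathfrak g\eta$ belong to the domains of $G^\pm(\eta)$ and $$\partial_t\eta=-\frac1{\mu^-}G^-(\eta)f^-,\qquad f^--f^+=\mathfrak sH(\eta)+(\rho^--\rho^+)\mathfrak g\eta,\qquad \frac1{\mu^+}G^+(\eta)f^+-\frac1{\mu^-}G^-(\eta)f^-=0.\tag{2}$$ Conversely, if $\eta$ and some functions $f^\pm$ in the domains of $G^\pm(\eta)$ satisfy (2), then there are $u^\pm,p^\pm$ such that $(u^\pm,p^\pm,\eta)$ solves the two-phase Muskat problem. -/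

import Mathlib

open MeasureTheory Set
open scoped ContDiff NNReal

noncomputable section

namespace Muskat

/-- Horizontal space `ℝ^d` with its Euclidean structure. -/
abbrev Hor (d : ℕ) : Type := EuclideanSpace ℝ (Fin d)

/-- The space `ℝ^d × ℝ` of points `(x, y)`, also used for vectors `(X, Y)`. -/
abbrev Pt (d : ℕ) : Type := Hor d × ℝ

/-- A rigid boundary `Γ`: either empty (`none`, infinite depth) or the graph of a function. -/
abbrev Rigid (d : ℕ) : Type := Option (Hor d → ℝ)

/-- `lower` is the phase `-` (below the interface), `upper` is the phase `+` (above it). -/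
inductive Phase
  | lower
  | upper

/-- `+1` if the upward normal of the interface points out of the phase, `-1` if it points in. -/
def Phase.sign : Phase → ℝ
  | Phase.lower => 1
  | Phase.upper => -1

/-- Smooth compactly supported functions. -/
def IsTest {V : Type*} [NormedAddCommGroup V] [NormedSpace ℝ V] (ψ : V → ℝ) : Prop :=
  ContDiff ℝ ∞ ψ ∧ HasCompactSupport ψ

variable {d : ℕ}

/-- Euclidean inner product of `ℝ^d × ℝ`. -/
def dot (a b : Pt d) : ℝ := inner ℝ a.1 b.1 + a.2 * b.2

/-- The vertical unit vector `e_{d+1}`. -/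
def eVert : Pt d := (0, 1)

/-- The gradient `∇_{x,y} ψ`. -/
def grad (ψ : Pt d → ℝ) (z : Pt d) : Pt d :=
  (gradient (fun x => ψ (x, z.2)) z.1, deriv (fun y => ψ (z.1, y)) z.2)

/-- The rigid boundary as a set. -/
def rigidSet (b : Rigid d) : Set (Pt d) := {z | ∃ β ∈ b, z.2 = β z.1}

/-- The fluid domains `Ω⁻` and `Ω⁺`. -/
def fluid : Phase → (Hor d → ℝ) → Rigid d → Set (Pt d)
  | Phase.lower, η, b => {z | z.2 < η z.1 ∧ ∀ β ∈ b, β z.1 < z.2}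
  | Phase.upper, η, b => {z | η z.1 < z.2 ∧ ∀ β ∈ b, z.2 < β z.1}

/-- The interface lies on the right side of the rigid boundary, at a positive distance. -/
def Separated : Phase → (Hor d → ℝ) → Rigid d → Prop
  | Phase.lower, η, b => ∃ h : ℝ, 0 < h ∧ ∀ β ∈ b, ∀ x, β x + h ≤ η x
  | Phase.upper, η, b => ∃ h : ℝ, 0 < h ∧ ∀ β ∈ b, ∀ x, η x + h ≤ β x

/-- `b` is empty or the graph of a function with bounded gradient. -/
def RigidLipschitz (b : Rigid d) : Prop := ∀ β ∈ b, ∃ K : ℝ≥0, LipschitzWith K β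

/-! ### Sobolev functions, traces, fluxes -/

/-- `φ` is `H¹` on the bounded parts of `Ω`, with weak gradient `w`. -/
structure HasWeakGrad (Ω : Set (Pt d)) (φ : Pt d → ℝ) (w : Pt d → Pt d) : Prop where
  memLp : ∀ K : Set (Pt d), IsCompact K → MemLp φ 2 (volume.restrict (Ω ∩ K))
  memLp_grad : ∀ K : Set (Pt d), IsCompact K → MemLp w 2 (volume.restrict (Ω ∩ K))
  integral_eq : ∀ ψ : Pt d → ℝ, IsTest ψ → tsupport ψ ⊆ Ω →
    ∫ z in Ω, φ z • grad ψ z = -∫ z in Ω, ψ z • w z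

/-- `φ` belongs to the homogeneous Sobolev space `Ḣ¹(Ω)`, with weak gradient `w ∈ L²(Ω)`. -/
def FiniteEnergy (Ω : Set (Pt d)) (φ : Pt d → ℝ) (w : Pt d → Pt d) : Prop :=
  HasWeakGrad Ω φ w ∧ MemLp w 2 (volume.restrict Ω)

/-- `f` is the trace `x ↦ φ(x, η(x))` on the interface of the function `φ` with weak gradient `w`,
in the sense of integration by parts in the vertical direction against all test functions that
vanish near the rigid boundary. -/
def IsTrace (P : Phase) (η : Hor d → ℝ) (b : Rigid d) (φ : Pt d → ℝ) (w : Pt d → Pt d)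
    (f : Hor d → ℝ) : Prop :=
  LocallyIntegrable f ∧
    ∀ ψ : Pt d → ℝ, IsTest ψ → Disjoint (tsupport ψ) (rigidSet b) →
      ∫ z in fluid P η b, (φ z * (grad ψ z).2 + (w z).2 * ψ z)
        = P.sign * ∫ x, f x * ψ (x, η x)

/-- `div w = 0` in `Ω`, in the sense of distributions. -/
def DivFree (Ω : Set (Pt d)) (w : Pt d → Pt d) : Prop :=
  ∀ ψ : Pt d → ℝ, IsTest ψ → tsupport ψ ⊆ Ω → ∫ z in Ω, dot (w z) (grad ψ z) = 0

/-- `w · ν = 0` on the rigid boundary for a divergence free field `w ∈ L²(Ω)`, in the weak sense: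
`∫_Ω w · ∇v = 0` for every `v ∈ Ḣ¹(Ω)` with zero trace on the interface. -/
def NoFlux (P : Phase) (η : Hor d → ℝ) (b : Rigid d) (w : Pt d → Pt d) : Prop :=
  ∀ (v : Pt d → ℝ) (wv : Pt d → Pt d), FiniteEnergy (fluid P η b) v wv →
    IsTrace P η b v wv (fun _ => 0) → ∫ z in fluid P η b, dot (w z) (wv z) = 0

/-- The weak normal trace `√(1+|∇η|²) w · n` on the interface (`n` the upward unit normal) of a
divergence free field `w ∈ L²(Ω)` with `w · ν = 0` on the rigid boundary. It is a distribution
carried by the interface, given by Green's formula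
`∫_{ℝ^d} √(1+|∇η|²) (w · n)(x, η(x)) ψ(x, η(x)) dx = ± ∫_Ω w · ∇ψ`. -/
def normalFlux (P : Phase) (η : Hor d → ℝ) (b : Rigid d) (w : Pt d → Pt d)
    (ψ : Pt d → ℝ) : ℝ :=
  P.sign * ∫ z in fluid P η b, dot (w z) (grad ψ z)

/-- The function `g` on `ℝ^d`, carried to the interface, as a distribution. -/
def onInterface (η g : Hor d → ℝ) (ψ : Pt d → ℝ) : ℝ := ∫ x, g x * ψ (x, η x)

/-- The mean curvature `H(η) = -div(∇η / √(1+|∇η|²))` as a distribution on `ℝ^d`. -/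
def meanCurvature (η : Hor d → ℝ) (ψ : Hor d → ℝ) : ℝ :=
  ∫ x, inner ℝ (gradient η x) (gradient ψ x) / √(1 + ‖gradient η x‖ ^ 2)

/-! ### The Dirichlet-Neumann operator -/

/-- `φ`, with gradient `w`, is the variational solution of `Δφ = 0` in `Ω`, `φ = f` on the
interface, `∂φ/∂ν = 0` on the rigid boundary. In infinite depth the decay of `∇φ` is contained in
`∇φ ∈ L²(Ω)`. -/
structure IsHarmonicExtension (P : Phase) (η : Hor d → ℝ) (b : Rigid d) (f : Hor d → ℝ)
    (φ : Pt d → ℝ) (w : Pt d → Pt d) : Prop where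
  finiteEnergy : FiniteEnergy (fluid P η b) φ w
  harmonic : DivFree (fluid P η b) w
  dirichlet : IsTrace P η b φ w f
  neumann : NoFlux P η b w

/-- The Dirichlet data: traces on the interface of functions in `Ḣ¹(Ω)`. -/
def IsDirichletData (P : Phase) (η : Hor d → ℝ) (b : Rigid d) (f : Hor d → ℝ) : Prop :=
  ∃ φ w, FiniteEnergy (fluid P η b) φ w ∧ IsTrace P η b φ w f

open Classical in
/-- The Dirichlet-Neumann operator `G^±(η) f = √(1+|∇η|²) ∂φ/∂n`, where `φ` is the variational
solution with Dirichlet data `f`. -/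
def DN (P : Phase) (η : Hor d → ℝ) (b : Rigid d) (f : Hor d → ℝ) (ψ : Pt d → ℝ) : ℝ :=
  if h : ∃ w, ∃ φ, IsHarmonicExtension P η b f φ w then normalFlux P η b h.choose ψ else 0

/-! ### The operator is well defined -/

lemma hasFDerivAt_fst {ψ : Pt d → ℝ} (h : IsTest ψ) (z : Pt d) :
    HasFDerivAt (fun x => ψ (x, z.2)) ((fderiv ℝ ψ z).comp (ContinuousLinearMap.inl ℝ (Hor d) ℝ))
      z.1 := by
  have h1 : HasFDerivAt ψ (fderiv ℝ ψ z) (z.1, z.2) :=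
    ((h.1.differentiable (by simp)) z).hasFDerivAt
  exact h1.comp z.1 (hasFDerivAt_prodMk_left z.1 z.2)

lemma hasFDerivAt_snd {ψ : Pt d → ℝ} (h : IsTest ψ) (z : Pt d) :
    HasFDerivAt (fun y => ψ (z.1, y)) ((fderiv ℝ ψ z).comp (ContinuousLinearMap.inr ℝ (Hor d) ℝ))
      z.2 := by
  have h1 : HasFDerivAt ψ (fderiv ℝ ψ z) (z.1, z.2) :=
    ((h.1.differentiable (by simp)) z).hasFDerivAt
  exact h1.comp z.2 (hasFDerivAt_prodMk_right z.1 z.2)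

lemma grad_eq {ψ : Pt d → ℝ} (h : IsTest ψ) (z : Pt d) :
    grad ψ z = ((InnerProductSpace.toDual ℝ (Hor d)).symm
      ((fderiv ℝ ψ z).comp (ContinuousLinearMap.inl ℝ (Hor d) ℝ)), fderiv ℝ ψ z (0, 1)) := by
  unfold grad gradient
  rw [(hasFDerivAt_fst h z).fderiv, (hasFDerivAt_snd h z).hasDerivAt.deriv]
  simp

lemma continuous_grad {ψ : Pt d → ℝ} (h : IsTest ψ) : Continuous (grad ψ) := by
  have hc : Continuous (fderiv ℝ ψ) := h.1.continuous_fderiv (by simp)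
  have : grad ψ = fun z => ((InnerProductSpace.toDual ℝ (Hor d)).symm
      ((fderiv ℝ ψ z).comp (ContinuousLinearMap.inl ℝ (Hor d) ℝ)), fderiv ℝ ψ z (0, 1)) :=
    funext (grad_eq h)
  rw [this]
  fun_prop

lemma grad_eq_zero {ψ : Pt d → ℝ} (h : IsTest ψ) {z : Pt d} (hz : z ∉ tsupport ψ) :
    grad ψ z = 0 := by
  have h0 : fderiv ℝ ψ z = 0 := by
    by_contra hne
    exact hz (support_fderiv_subset ℝ hne)
  rw [grad_eq h, h0]
  simp

lemma integrable_smul_of_memLp {F : Type*} [NormedAddCommGroup F] [NormedSpace ℝ F]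
    {Ω K : Set (Pt d)} (hK : IsCompact K) {a : Pt d → ℝ} {c : Pt d → F}
    (ha : MemLp a 2 (volume.restrict (Ω ∩ K))) (hc : MemLp c 2 (volume.restrict (Ω ∩ K)))
    (h0 : ∀ z ∉ K, a z • c z = 0) : IntegrableOn (fun z => a z • c z) Ω := by
  have h1 : IntegrableOn (fun z => a z • c z) K (volume.restrict Ω) := by
    rw [IntegrableOn, Measure.restrict_restrict hK.measurableSet, inter_comm]
    have := hc.smul (r := 1) ha
    exact memLp_one_iff_integrable.1 this
  refine (integrableOn_iff_integrable_of_support_subset ?_).1 h1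
  intro z hz
  by_contra hzK
  exact hz (h0 z hzK)

lemma memLp_of_continuous {F : Type*} [NormedAddCommGroup F] [SecondCountableTopology F]
    {Ω K : Set (Pt d)} (hK : IsCompact K) {c : Pt d → F} (hc : Continuous c) :
    MemLp c 2 (volume.restrict (Ω ∩ K)) := by
  have : MemLp c 2 (volume.restrict K) := by
    have : IsFiniteMeasure (volume.restrict K) := ⟨by
      rw [Measure.restrict_apply_univ]; exact hK.measure_lt_top⟩
    obtain ⟨C, hC⟩ := hK.exists_bound_of_continuousOn hc.continuousOn
    refine MemLp.of_bound hc.aestronglyMeasurable C ?_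
    exact (ae_restrict_iff' hK.measurableSet).2 (Filter.Eventually.of_forall hC)
  exact this.mono_measure (Measure.restrict_mono inter_subset_right le_rfl)

lemma HasWeakGrad.sub {Ω : Set (Pt d)} {φ₁ φ₂ : Pt d → ℝ} {w₁ w₂ : Pt d → Pt d}
    (h₁ : HasWeakGrad Ω φ₁ w₁) (h₂ : HasWeakGrad Ω φ₂ w₂) :
    HasWeakGrad Ω (fun z => φ₁ z - φ₂ z) (fun z => w₁ z - w₂ z) where
  memLp K hK := (h₁.memLp K hK).sub (h₂.memLp K hK)
  memLp_grad K hK := (h₁.memLp_grad K hK).sub (h₂.memLp_grad K hK)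
  integral_eq ψ hψ hs := by
    have hK : IsCompact (tsupport ψ) := hψ.2
    have key : ∀ {φ w}, HasWeakGrad Ω φ w → IntegrableOn (fun z => φ z • grad ψ z) Ω ∧
        IntegrableOn (fun z => ψ z • w z) Ω := fun h =>
      ⟨integrable_smul_of_memLp hK (h.memLp _ hK) (memLp_of_continuous hK (continuous_grad hψ))
          fun z hz => by rw [grad_eq_zero hψ hz, smul_zero],
        integrable_smul_of_memLp hK (memLp_of_continuous hK hψ.1.continuous) (h.memLp_grad _ hK)
          fun z hz => by rw [image_eq_zero_of_notMem_tsupport hz, zero_smul]⟩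
    simp only [sub_smul, smul_sub]
    rw [integral_sub (key h₁).1 (key h₂).1, integral_sub (key h₁).2 (key h₂).2,
      h₁.integral_eq ψ hψ hs, h₂.integral_eq ψ hψ hs]
    abel

lemma IsTrace.sub {P : Phase} {η : Hor d → ℝ} {b : Rigid d} {φ₁ φ₂ : Pt d → ℝ}
    {w₁ w₂ : Pt d → Pt d} {f : Hor d → ℝ}
    (g₁ : HasWeakGrad (fluid P η b) φ₁ w₁) (g₂ : HasWeakGrad (fluid P η b) φ₂ w₂)
    (h₁ : IsTrace P η b φ₁ w₁ f) (h₂ : IsTrace P η b φ₂ w₂ f) :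
    IsTrace P η b (fun z => φ₁ z - φ₂ z) (fun z => w₁ z - w₂ z) (fun _ => 0) := by
  refine ⟨locallyIntegrable_zero, fun ψ hψ hs => ?_⟩
  have hK : IsCompact (tsupport ψ) := hψ.2
  have key : ∀ {φ w}, HasWeakGrad (fluid P η b) φ w →
      IntegrableOn (fun z => φ z * (grad ψ z).2 + (w z).2 * ψ z) (fluid P η b) := fun {φ w} h => by
    refine Integrable.add ?_ ?_
    · exact integrable_smul_of_memLp hK (h.memLp _ hK)
        (memLp_of_continuous hK (continuous_grad hψ).snd)
        fun z hz => by rw [grad_eq_zero hψ hz]; simp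
    · exact integrable_smul_of_memLp (a := fun z => (w z).2) hK (h.memLp_grad _ hK).snd
        (memLp_of_continuous hK hψ.1.continuous)
        fun z hz => by rw [image_eq_zero_of_notMem_tsupport hz, smul_zero]
  have h := integral_sub (key g₁) (key g₂)
  rw [h₁.2 ψ hψ hs, h₂.2 ψ hψ hs, sub_self] at h
  simp only [zero_mul, integral_zero, mul_zero]
  rw [← h]
  congr 1
  ext z
  simp only [Prod.snd_sub]
  ring

lemma integrable_dot {Ω : Set (Pt d)} {a c : Pt d → Pt d} (ha : MemLp a 2 (volume.restrict Ω))
    (hc : MemLp c 2 (volume.restrict Ω)) : IntegrableOn (fun z => dot (a z) (c z)) Ω := by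
  refine Integrable.add ?_ ?_
  · have ha' : MemLp (fun z => (a z).1) 2 (volume.restrict Ω) := ha.fst
    have hc' : MemLp (fun z => (c z).1) 2 (volume.restrict Ω) := hc.fst
    refine (L2.integrable_inner (𝕜 := ℝ) (ha'.toLp _) (hc'.toLp _)).congr ?_
    filter_upwards [ha'.coeFn_toLp, hc'.coeFn_toLp] with z h1 h2
    rw [h1, h2]
  · exact MemLp.integrable_mul (p := 2) (q := 2) ha.snd hc.snd

/-- The gradient of the variational solution is unique, so `DN` does not depend on choices. -/
theorem IsHarmonicExtension.grad_unique {P : Phase} {η : Hor d → ℝ} {b : Rigid d}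
    {f : Hor d → ℝ} {φ₁ φ₂ : Pt d → ℝ} {w₁ w₂ : Pt d → Pt d}
    (h₁ : IsHarmonicExtension P η b f φ₁ w₁) (h₂ : IsHarmonicExtension P η b f φ₂ w₂) :
    w₁ =ᵐ[volume.restrict (fluid P η b)] w₂ := by
  have hL := h₁.finiteEnergy.2.sub h₂.finiteEnergy.2
  have hv : FiniteEnergy (fluid P η b) (fun z => φ₁ z - φ₂ z) (fun z => w₁ z - w₂ z) :=
    ⟨h₁.finiteEnergy.1.sub h₂.finiteEnergy.1, hL⟩
  have ht := h₁.dirichlet.sub h₁.finiteEnergy.1 h₂.finiteEnergy.1 h₂.dirichlet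
  have e₁ := h₁.neumann _ _ hv ht
  have e₂ := h₂.neumann _ _ hv ht
  have e := integral_sub (integrable_dot h₁.finiteEnergy.2 hL) (integrable_dot h₂.finiteEnergy.2 hL)
  have hd : ∀ z, dot (w₁ z) ((w₁ - w₂) z) - dot (w₂ z) ((w₁ - w₂) z)
      = ‖(w₁ z).1 - (w₂ z).1‖ ^ 2 + ((w₁ z).2 - (w₂ z).2) ^ 2 := fun z => by
    simp only [dot, Pi.sub_apply, Prod.fst_sub, Prod.snd_sub]
    rw [← real_inner_self_eq_norm_sq, inner_sub_left]
    ring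
  have hi := (integrable_dot h₁.finiteEnergy.2 hL).sub (integrable_dot h₂.finiteEnergy.2 hL)
  have hz : ∫ z in fluid P η b,
      (dot (w₁ z) ((w₁ - w₂) z) - dot (w₂ z) ((w₁ - w₂) z)) = 0 := by
    rw [e]
    exact (congrArg₂ (· - ·) e₁ e₂).trans (sub_self 0)
  have h0 := (integral_eq_zero_iff_of_nonneg (fun z => by
    
      have : (0 : ℝ) ≤ ‖(w₁ z).1 - (w₂ z).1‖ ^ 2 + ((w₁ z).2 - (w₂ z).2) ^ 2 := by positivity
      exact this.trans_eq (hd z).symm) hi).1 hz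
  filter_upwards [h0] with z hz
  replace hz := (hd z).symm.trans hz
  rw [Pi.zero_apply] at hz
  have hp := sq_nonneg ((w₁ z).2 - (w₂ z).2)
  have hq := sq_nonneg (norm ((w₁ z).1 - (w₂ z).1))
  have ha : ‖(w₁ z).1 - (w₂ z).1‖ ^ 2 = 0 := by linarith
  have hb : ((w₁ z).2 - (w₂ z).2) ^ 2 = 0 := by linarith
  refine Prod.ext ?_ ?_
  · exact sub_eq_zero.1 (norm_eq_zero.1 (pow_eq_zero_iff (by norm_num) |>.1 ha))
  · exact sub_eq_zero.1 (pow_eq_zero_iff (by norm_num) |>.1 hb)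

/-! ### Time-dependent problems -/

/-- `ηt` is the (weak) time derivative of `η` on `(0,T) × ℝ^d`. -/
structure IsTimeDeriv (T : ℝ) (η ηt : ℝ → Hor d → ℝ) : Prop where
  locInt : LocallyIntegrableOn (Function.uncurry η) (Ioo 0 T ×ˢ univ)
  locInt_deriv : LocallyIntegrableOn (Function.uncurry ηt) (Ioo 0 T ×ˢ univ)
  integral_eq : ∀ ψ : ℝ × Hor d → ℝ, IsTest ψ → tsupport ψ ⊆ Ioo 0 T ×ˢ univ →
    ∫ z in Ioo 0 T ×ˢ univ, η z.1 z.2 * deriv (fun t => ψ (t, z.2)) z.1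
      = -∫ z in Ioo 0 T ×ˢ univ, ηt z.1 z.2 * ψ z

/-- At almost every time the interface is the graph of a Lipschitz function at a positive distance
from the rigid boundary. -/
def Admissible (P : Phase) (T : ℝ) (b : Rigid d) (η : ℝ → Hor d → ℝ) : Prop :=
  ∀ᵐ t ∂volume.restrict (Ioo 0 T), (∃ K : ℝ≥0, LipschitzWith K (η t)) ∧ Separated P (η t) b

/-- Darcy's law, incompressibility and no penetration in one phase, at a fixed time, for a
square integrable velocity `u` and a pressure `p` whose trace on the interface is `π`. -/
structure IsDarcyFlow (P : Phase) (μ ρ g : ℝ) (η : Hor d → ℝ) (b : Rigid d)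
    (u : Pt d → Pt d) (p : Pt d → ℝ) (π : Hor d → ℝ) : Prop where
  finiteEnergy : MemLp u 2 (volume.restrict (fluid P η b))
  darcy : HasWeakGrad (fluid P η b) p (fun z => -((ρ * g) • eVert) - μ • u z)
  divFree : DivFree (fluid P η b) u
  noPenetration : NoFlux P η b u
  trace : IsTrace P η b p (fun z => -((ρ * g) • eVert) - μ • u z) π

/-- `(u, p, η)` solves the one-phase Muskat problem on `(0,T)`. -/
def OnePhaseMuskat (μ ρ g s T : ℝ) (b : Rigid d) (η : ℝ → Hor d → ℝ)
    (u : ℝ → Pt d → Pt d) (p : ℝ → Pt d → ℝ) : Prop :=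
  ∃ ηt, IsTimeDeriv T η ηt ∧ ∀ᵐ t ∂volume.restrict (Ioo 0 T),
    ∃ π : Hor d → ℝ, IsDarcyFlow Phase.lower μ ρ g (η t) b (u t) (p t) π ∧
      -- `∂_t η = √(1+|∇η|²) u · n` on the interface
      (∀ ψ, IsTest ψ → onInterface (η t) (ηt t) ψ = normalFlux Phase.lower (η t) b (u t) ψ) ∧
      -- `p = s H(η)` on the interface
      (∀ ψ, IsTest ψ → ∫ x, π x * ψ x = s * meanCurvature (η t) ψ)

/-- `η` solves `∂_t η = -(1/μ) G⁻(η)(s H(η) + ρ g η)` on `(0,T)`; here `f` is the function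
`s H(η) + ρ g η`. -/
def OnePhaseDN (μ ρ g s T : ℝ) (b : Rigid d) (η : ℝ → Hor d → ℝ) : Prop :=
  ∃ ηt, IsTimeDeriv T η ηt ∧ ∀ᵐ t ∂volume.restrict (Ioo 0 T),
    ∃ f : Hor d → ℝ, IsDirichletData Phase.lower (η t) b f ∧
      (∀ ψ, IsTest ψ →
        ∫ x, f x * ψ x = s * meanCurvature (η t) ψ + ρ * g * ∫ x, η t x * ψ x) ∧
      (∀ ψ, IsTest ψ →
        onInterface (η t) (ηt t) ψ = -(1 / μ) * DN Phase.lower (η t) b f ψ)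

/-- `(u^±, p^±, η)` solves the two-phase Muskat problem on `(0,T)`; `π^±` are the traces of the
pressures on the interface. -/
def TwoPhaseMuskat (μm μp ρm ρp g s T : ℝ) (bm bp : Rigid d) (η : ℝ → Hor d → ℝ)
    (um up : ℝ → Pt d → Pt d) (pm pp : ℝ → Pt d → ℝ) : Prop :=
  ∃ ηt, IsTimeDeriv T η ηt ∧ ∀ᵐ t ∂volume.restrict (Ioo 0 T),
    ∃ πm πp : Hor d → ℝ,
      IsDarcyFlow Phase.lower μm ρm g (η t) bm (um t) (pm t) πm ∧
      IsDarcyFlow Phase.upper μp ρp g (η t) bp (up t) (pp t) πp ∧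
      -- `u⁺ · n = u⁻ · n` on the interface
      (∀ ψ, IsTest ψ → normalFlux Phase.upper (η t) bp (up t) ψ
        = normalFlux Phase.lower (η t) bm (um t) ψ) ∧
      -- `∂_t η = √(1+|∇η|²) u⁻ · n` on the interface
      (∀ ψ, IsTest ψ → onInterface (η t) (ηt t) ψ = normalFlux Phase.lower (η t) bm (um t) ψ) ∧
      -- `p⁻ - p⁺ = s H(η)` on the interface
      (∀ ψ, IsTest ψ → ∫ x, (πm x - πp x) * ψ x = s * meanCurvature (η t) ψ)

/-- `∂_t η = -(1/μ⁻) G⁻(η) f⁻` on `(0,T)`, where `f^±` solve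
`f⁻ - f⁺ = s H(η) + (ρ⁻ - ρ⁺) g η` and `(1/μ⁺) G⁺(η) f⁺ - (1/μ⁻) G⁻(η) f⁻ = 0`. -/
def TwoPhaseDN (μm μp ρm ρp g s T : ℝ) (bm bp : Rigid d) (η fm fp : ℝ → Hor d → ℝ) : Prop :=
  ∃ ηt, IsTimeDeriv T η ηt ∧ ∀ᵐ t ∂volume.restrict (Ioo 0 T),
    IsDirichletData Phase.lower (η t) bm (fm t) ∧
    IsDirichletData Phase.upper (η t) bp (fp t) ∧
    (∀ ψ, IsTest ψ → ∫ x, (fm t x - fp t x) * ψ x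
      = s * meanCurvature (η t) ψ + (ρm - ρp) * g * ∫ x, η t x * ψ x) ∧
    (∀ ψ, IsTest ψ → 1 / μp * DN Phase.upper (η t) bp (fp t) ψ
      - 1 / μm * DN Phase.lower (η t) bm (fm t) ψ = 0) ∧
    (∀ ψ, IsTest ψ →
      onInterface (η t) (ηt t) ψ = -(1 / μm) * DN Phase.lower (η t) bm (fm t) ψ)

/-- `f(t) = p(t)|_Σ + ρ g η(t)` for almost every `t`, where the velocity `u` and Darcy's law give
the weak gradient of the pressure `p`. -/
def IsModifiedTrace (P : Phase) (μ ρ g T : ℝ) (b : Rigid d) (η : ℝ → Hor d → ℝ)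
    (u : ℝ → Pt d → Pt d) (p : ℝ → Pt d → ℝ) (f : ℝ → Hor d → ℝ) : Prop :=
  ∀ᵐ t ∂volume.restrict (Ioo 0 T), ∃ π : Hor d → ℝ,
    IsTrace P (η t) b (p t) (fun z => -((ρ * g) • eVert) - μ • u t z) π ∧
      ∀ x, f t x = π x + ρ * g * η t x

end Muskat

end

noncomputable section

namespace Muskat

variable {d : ℕ}

/-! ### Geometry of the fluid domains -/

/-! Darcy's law says that the modified pressure `φ = p + ρ g y` has gradient `-μ u`. Hence, at
almost every time, `u` is a square integrable, divergence free field without flux through the rigid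
boundary exactly when `φ` is the variational harmonic extension of `p|_Σ + ρ g η`. The normal flux
of `-μ u` is then the Dirichlet-Neumann operator applied to that trace, and the kinematic and
dynamic conditions turn into the equations for `η`. This dictionary is
`IsDarcyFlow.isHarmonicExtension` and `IsHarmonicExtension.isDarcyFlow`; `IsHarmonicExtension.DN_eq`
connects it with `DN`.

The converse directions also need the variational solution to exist for arbitrary Dirichlet data
(`IsDirichletData.exists_isHarmonicExtension`). Starting from any finite energy function with the
given trace and gradient `w₀`, one subtracts from `w₀` its orthogonal projection in `L²` onto the
gradients of finite energy functions with zero trace. This requires that space to be closed.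

Closedness follows from writing the space as an orthogonal complement. A function with zero trace is
recovered from the vertical component of its gradient by vertical integration from the interface
(`potential`). The adjoint of this integration, by Fubini, is the sweeping of a test function
towards the interface (`sweep`). Thus a field `w` is a gradient of the required kind if and only if
it is orthogonal to all fields `corrector P M ψ a`; the two implications are
`integral_dot_corrector_of_isTrace_zero` and `exists_potential_of_integral_dot_corrector`. -/

lemma Phase.sign_mul_self (P : Phase) : P.sign * P.sign = 1 := by
  cases P <;> simp [Phase.sign]

lemma mem_fluid_iff {P : Phase} {η : Hor d → ℝ} {b : Rigid d} {z : Pt d} :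
    z ∈ fluid P η b ↔ P.sign * z.2 < P.sign * η z.1 ∧
      ∀ β ∈ b, P.sign * β z.1 < P.sign * z.2 := by
  cases P <;> simp [fluid, Phase.sign]

lemma RigidLipschitz.continuous {b : Rigid d} (hb : RigidLipschitz b) {β : Hor d → ℝ}
    (hβ : β ∈ b) : Continuous β := by
  obtain ⟨K, hK⟩ := hb β hβ
  exact hK.continuous

lemma isOpen_fluid (P : Phase) {η : Hor d → ℝ} {b : Rigid d} (hη : Continuous η)
    (hb : RigidLipschitz b) : IsOpen (fluid P η b) := by
  have h : fluid P η b = {z | P.sign * z.2 < P.sign * η z.1} ∩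
      {z | ∀ β ∈ b, P.sign * β z.1 < P.sign * z.2} := by
    ext z
    exact mem_fluid_iff
  rw [h]
  refine (isOpen_lt (by fun_prop) (by fun_prop)).inter ?_
  cases b with
  | none => simp
  | some β =>
    have := hb.continuous (β := β) rfl
    simpa using isOpen_lt (f := fun z : Pt d => P.sign * β z.1) (g := fun z => P.sign * z.2)
      (by fun_prop) (by fun_prop)

/-- The vertical section, over the point `x`, of the part of the phase that is cut off at
height `c`. -/
def column (P : Phase) (b : Rigid d) (x : Hor d) (c : ℝ) : Set ℝ :=
  {y | P.sign * y < P.sign * c ∧ ∀ β ∈ b, P.sign * β x < P.sign * y}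

/-- The fundamental theorem of calculus on one vertical section. The end away from the interface
contributes nothing, by compact support in infinite depth and by `h0` otherwise; `P.sign` records on
which side of the section the interface lies. -/
lemma setIntegral_column_deriv (P : Phase) {b : Rigid d} {x : Hor d} {c : ℝ}
    (hc : ∀ β ∈ b, P.sign * β x < P.sign * c) {F : ℝ → ℝ} (hF : ContDiff ℝ 1 F)
    (hF' : HasCompactSupport F) (h0 : ∀ β ∈ b, F (β x) = 0) :
    ∫ y in column P b x c, deriv F y = P.sign * F c := by
  have hi : ∀ p q, ∫ y in p..q, deriv F y = F q - F p := fun p q =>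
    intervalIntegral.integral_deriv_eq_sub (fun y _ => hF.differentiable one_ne_zero y)
      ((hF.continuous_deriv le_rfl).intervalIntegrable _ _)
  cases b with
  | none =>
    cases P with
    | lower =>
      have : column Phase.lower none x c = Iio c := by
        ext y; simp [column, Phase.sign]
      rw [this, ← integral_Iic_eq_integral_Iio, hF'.integral_Iic_deriv_eq hF]
      simp [Phase.sign]
    | upper =>
      have : column Phase.upper none x c = Ioi c := by
        ext y; simp [column, Phase.sign]
      rw [this, hF'.integral_Ioi_deriv_eq hF]
      simp [Phase.sign]
  | some β =>
    have hc' := hc β rfl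
    have h0' := h0 β rfl
    cases P with
    | lower =>
      have : column Phase.lower (some β) x c = Ioo (β x) c := by
        ext y; simp [column, Phase.sign, and_comm]
      simp only [Phase.sign, one_mul] at hc'
      rw [this, ← integral_Ioc_eq_integral_Ioo, ← intervalIntegral.integral_of_le hc'.le, hi]
      simp [Phase.sign, h0']
    | upper =>
      have : column Phase.upper (some β) x c = Ioo c (β x) := by
        ext y; simp [column, Phase.sign]
      simp only [Phase.sign, neg_mul, one_mul, neg_lt_neg_iff] at hc'
      rw [this, ← integral_Ioc_eq_integral_Ioo, ← intervalIntegral.integral_of_le hc'.le, hi]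
      simp [Phase.sign, h0']

/-! ### Smooth functions: weak gradients and traces -/

instance : (volume : Measure (Pt d)).IsAddHaarMeasure :=
  inferInstanceAs ((volume : Measure (Hor d)).prod (volume : Measure ℝ)).IsAddHaarMeasure

lemma dot_grad {ψ : Pt d → ℝ} (h : IsTest ψ) (z a : Pt d) : dot (grad ψ z) a = fderiv ℝ ψ z a := by
  rw [grad_eq h]
  simp only [dot, InnerProductSpace.toDual_symm_apply, ContinuousLinearMap.comp_apply,
    ContinuousLinearMap.inl_apply]
  have : a = (a.1, (0 : ℝ)) + a.2 • ((0 : Hor d), (1 : ℝ)) := by ext <;> simp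
  conv_rhs => rw [this, map_add, map_smul]
  rw [smul_eq_mul, mul_comm]

lemma grad_snd {ψ : Pt d → ℝ} (h : IsTest ψ) (z : Pt d) :
    (grad ψ z).2 = fderiv ℝ ψ z (0, 1) := by
  rw [grad_eq h]

lemma IsTest.fderiv_apply {ψ : Pt d → ℝ} (h : IsTest ψ) (a : Pt d) :
    IsTest (fun z => fderiv ℝ ψ z a) :=
  ⟨(h.1.fderiv_right (m := ∞) (by simp)).clm_apply contDiff_const, h.2.fderiv_apply ℝ a⟩

lemma tsupport_fderiv_apply_subset {ψ : Pt d → ℝ} (a : Pt d) :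
    tsupport (fun z => fderiv ℝ ψ z a) ⊆ tsupport ψ := by
  refine closure_minimal (fun z hz => ?_) (isClosed_tsupport _)
  refine support_fderiv_subset ℝ fun h => hz ?_
  simp [h]

lemma IsTest.integrable {ψ : Pt d → ℝ} (h : IsTest ψ) : Integrable ψ :=
  h.1.continuous.integrable_of_hasCompactSupport h.2

lemma IsTest.mul_left {φ ψ : Pt d → ℝ} (hφ : ContDiff ℝ ∞ φ) (h : IsTest ψ) :
    IsTest (fun z => φ z * ψ z) :=
  ⟨hφ.mul h.1, h.2.mul_left⟩

lemma IsTest.slice {ψ : Pt d → ℝ} (h : IsTest ψ) (x : Hor d) :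
    ContDiff ℝ 1 (fun y => ψ (x, y)) ∧ HasCompactSupport (fun y => ψ (x, y)) := by
  refine ⟨(h.1.comp (contDiff_prodMk_right x)).of_le (by norm_cast), ?_⟩
  refine HasCompactSupport.of_support_subset_isCompact (h.2.image continuous_snd) ?_
  intro y hy
  exact ⟨(x, y), subset_tsupport _ hy, rfl⟩

lemma measurableSet_column (P : Phase) (b : Rigid d) (x : Hor d) (c : ℝ) :
    MeasurableSet (column P b x c) := by
  have h : column P b x c = {y | P.sign * y < P.sign * c} ∩
      {y | ∀ β ∈ b, P.sign * β x < P.sign * y} := rfl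
  rw [h]
  refine (measurableSet_lt (by fun_prop) (by fun_prop)).inter ?_
  cases b with
  | none => simp
  | some β =>
    simpa using measurableSet_lt (f := fun y : ℝ => P.sign * β x) (g := fun y => P.sign * y)
      (by fun_prop) (by fun_prop)

/-- The divergence theorem for vertical vector fields. -/
lemma setIntegral_fluid_fderiv_vert {P : Phase} {η : Hor d → ℝ} {b : Rigid d} (hη : Continuous η)
    (hb : RigidLipschitz b) (hs : ∀ β ∈ b, ∀ x, P.sign * β x < P.sign * η x) {F : Pt d → ℝ}
    (hF : IsTest F) (h0 : ∀ z ∈ rigidSet b, F z = 0) :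
    ∫ z in fluid P η b, fderiv ℝ F z (0, 1) = P.sign * ∫ x, F (x, η x) := by
  have hm := (isOpen_fluid P hη hb).measurableSet
  have hi : Integrable ((fluid P η b).indicator fun z => fderiv ℝ F z (0, 1)) :=
    (hF.fderiv_apply (0, 1)).integrable.indicator hm
  rw [← integral_indicator hm, Measure.volume_eq_prod, integral_prod _ hi, ← integral_const_mul]
  congr 1
  ext x
  have h1 : (fun y => (fluid P η b).indicator (fun z => fderiv ℝ F z (0, 1)) (x, y))
      = (column P b x (η x)).indicator (deriv fun y => F (x, y)) := by
    ext y
    have h2 : deriv (fun y => F (x, y)) y = fderiv ℝ F (x, y) (0, 1) := by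
      rw [(hasFDerivAt_snd hF (x, y)).hasDerivAt.deriv]
      simp
    simp only [indicator, mem_fluid_iff, column, mem_ofPred_eq, h2]
  rw [h1, integral_indicator (measurableSet_column _ _ _ _),
    setIntegral_column_deriv P (fun β hβ => hs β hβ x) (hF.slice x).1 (hF.slice x).2
      fun β hβ => h0 _ ⟨β, hβ, rfl⟩]

/-- The functionals `dot · a` are continuous, so they commute with the integral, and they separate
points. They are built by hand because `Pt d` carries the sup norm of a product and not the
Euclidean one. -/
lemma integral_pt_eq_iff_dot {μ : Measure (Pt d)} {F G : Pt d → Pt d} (hF : Integrable F μ)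
    (hG : Integrable G μ) :
    ∫ z, F z ∂μ = -∫ z, G z ∂μ ↔ ∀ a, ∫ z, dot (F z) a ∂μ = -∫ z, dot (G z) a ∂μ := by
  have key : ∀ {F : Pt d → Pt d}, Integrable F μ → ∀ a,
      ∫ z, dot (F z) a ∂μ = dot (∫ z, F z ∂μ) a := fun {F} hF a => by
    let L : Pt d →L[ℝ] ℝ := (innerSL ℝ a.1).comp (ContinuousLinearMap.fst ℝ _ _) +
      a.2 • ContinuousLinearMap.snd ℝ (Hor d) ℝ
    have hL : ∀ z, dot z a = L z := fun z => by
      simp [L, dot, real_inner_comm, mul_comm]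
    simp only [hL]
    exact L.integral_comp_comm hF
  have hneg : ∀ u a : Pt d, dot (-u) a = -dot u a := fun u a => by
    simp [dot]; ring
  constructor
  · intro h a
    rw [key hF, key hG, h, hneg]
  · intro h
    simp only [key hF, key hG, ← hneg] at h
    refine Prod.ext ?_ ?_
    · refine ext_inner_right ℝ fun v => ?_
      simpa [dot] using h (v, 0)
    · simpa [dot] using h (0, 1)

lemma integrable_smul_grad {Ω : Set (Pt d)} {φ : Pt d → ℝ}
    (hφ : ∀ K : Set (Pt d), IsCompact K → MemLp φ 2 (volume.restrict (Ω ∩ K)))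
    {ψ : Pt d → ℝ} (hψ : IsTest ψ) : IntegrableOn (fun z => φ z • grad ψ z) Ω :=
  integrable_smul_of_memLp hψ.2 (hφ _ hψ.2) (memLp_of_continuous hψ.2 (continuous_grad hψ))
    fun z hz => by rw [grad_eq_zero hψ hz, smul_zero]

lemma integrable_test_smul {F : Type*} [NormedAddCommGroup F] [NormedSpace ℝ F]
    {Ω : Set (Pt d)} {w : Pt d → F}
    (hw : ∀ K : Set (Pt d), IsCompact K → MemLp w 2 (volume.restrict (Ω ∩ K)))
    {ψ : Pt d → ℝ} (hψ : IsTest ψ) : IntegrableOn (fun z => ψ z • w z) Ω :=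
  integrable_smul_of_memLp hψ.2 (memLp_of_continuous hψ.2 hψ.1.continuous) (hw _ hψ.2)
    fun z hz => by rw [image_eq_zero_of_notMem_tsupport hz, zero_smul]

/-- The identity defining the weak gradient may be tested direction by direction. -/
lemma hasWeakGrad_iff {Ω : Set (Pt d)} {φ : Pt d → ℝ} {w : Pt d → Pt d}
    (hφ : ∀ K : Set (Pt d), IsCompact K → MemLp φ 2 (volume.restrict (Ω ∩ K)))
    (hw : ∀ K : Set (Pt d), IsCompact K → MemLp w 2 (volume.restrict (Ω ∩ K))) :
    HasWeakGrad Ω φ w ↔ ∀ ψ : Pt d → ℝ, IsTest ψ → tsupport ψ ⊆ Ω → ∀ a,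
      ∫ z in Ω, φ z * fderiv ℝ ψ z a = -∫ z in Ω, ψ z * dot (w z) a := by
  have hd : ∀ (c : ℝ) (u a : Pt d), dot (c • u) a = c * dot u a := fun c u a => by
    simp [dot, inner_smul_left]; ring
  have key : ∀ ψ : Pt d → ℝ, IsTest ψ →
      ((∫ z in Ω, φ z • grad ψ z = -∫ z in Ω, ψ z • w z) ↔ ∀ a,
        ∫ z in Ω, φ z * fderiv ℝ ψ z a = -∫ z in Ω, ψ z * dot (w z) a) := fun ψ hψ => by
    rw [integral_pt_eq_iff_dot (integrable_smul_grad hφ hψ) (integrable_test_smul hw hψ)]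
    simp only [hd, dot_grad hψ]
  exact ⟨fun h ψ hψ hs => (key ψ hψ).1 (h.integral_eq ψ hψ hs),
    fun h => ⟨hφ, hw, fun ψ hψ hs => (key ψ hψ).2 (h ψ hψ hs)⟩⟩

lemma hasWeakGrad_of_contDiff {Ω : Set (Pt d)} {φ : Pt d → ℝ}
    {w : Pt d → Pt d} (hφ : ContDiff ℝ ∞ φ) (hw : Continuous w)
    (h : ∀ z a, fderiv ℝ φ z a = dot (w z) a) : HasWeakGrad Ω φ w := by
  refine (hasWeakGrad_iff (fun K hK => memLp_of_continuous hK hφ.continuous)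
    fun K hK => memLp_of_continuous hK hw).2 fun ψ hψ hs a => ?_
  -- Since `ψ` is supported in `Ω`, both integrals extend to the whole space, where integration by
  -- parts has no boundary term.
  rw [setIntegral_eq_integral_of_forall_compl_eq_zero,
    setIntegral_eq_integral_of_forall_compl_eq_zero,
    integral_mul_fderiv_eq_neg_fderiv_mul_of_integrable]
  · simp only [h, mul_comm]
  · refine Continuous.integrable_of_hasCompactSupport ?_ hψ.2.mul_left
    exact ((hφ.continuous_fderiv (by simp)).clm_apply continuous_const).mul hψ.1.continuous
  · exact ((hψ.fderiv_apply a).mul_left hφ).integrable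
  · exact (hψ.mul_left hφ).integrable
  · exact fun x _ => hφ.differentiable (by simp) x
  · exact fun x _ => hψ.1.differentiable (by simp) x
  · intro z hz
    rw [image_eq_zero_of_notMem_tsupport fun h => hz (hs h), zero_mul]
  · intro z hz
    rw [← dot_grad hψ, grad_eq_zero hψ fun h => hz (hs h)]
    simp [dot]

lemma isTrace_of_contDiff {P : Phase} {η : Hor d → ℝ} {b : Rigid d} (hη : Continuous η)
    (hb : RigidLipschitz b) (hs : ∀ β ∈ b, ∀ x, P.sign * β x < P.sign * η x) {φ : Pt d → ℝ}
    {w : Pt d → Pt d} (hφ : ContDiff ℝ ∞ φ) (h : ∀ z a, fderiv ℝ φ z a = dot (w z) a) :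
    IsTrace P η b φ w (fun x => φ (x, η x)) := by
  have hφc := hφ.continuous
  refine ⟨(by fun_prop : Continuous fun x => φ (x, η x)).locallyIntegrable, fun ψ hψ hd => ?_⟩
  -- The integrand in the definition of the trace is the vertical derivative of the product `φ ψ`,
  -- which vanishes on the rigid boundary because `ψ` does.
  rw [← setIntegral_fluid_fderiv_vert hη hb hs (hψ.mul_left hφ)]
  · congr 1
    ext z
    rw [fderiv_fun_mul (hφ.differentiable (by simp) z) (hψ.1.differentiable (by simp) z),
      grad_snd hψ]
    simp [h, dot, mul_comm]
  · intro z hz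
    rw [image_eq_zero_of_notMem_tsupport fun h => hd.le_bot ⟨h, hz⟩, mul_zero]

/-! ### Linearity of weak gradients and traces. -/

lemma HasWeakGrad.integrable_trace_integrand {Ω : Set (Pt d)} {φ : Pt d → ℝ} {w : Pt d → Pt d}
    (h : HasWeakGrad Ω φ w) {ψ : Pt d → ℝ} (hψ : IsTest ψ) :
    IntegrableOn (fun z => φ z * (grad ψ z).2 + (w z).2 * ψ z) Ω := by
  refine Integrable.add ((integrable_smul_grad h.memLp hψ).snd) ?_
  refine (integrable_test_smul (w := fun z => (w z).2) (fun K hK => (h.memLp_grad K hK).snd)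
    hψ).congr (.of_forall fun z => ?_)
  simp [mul_comm]

lemma integrable_mul_interface {η f : Hor d → ℝ} (hη : Continuous η)
    (hf : LocallyIntegrable f) {ψ : Pt d → ℝ} (hψ : IsTest ψ) :
    Integrable fun x => f x * ψ (x, η x) := by
  have hψc := hψ.1.continuous
  have hc : HasCompactSupport fun x => ψ (x, η x) := by
    refine HasCompactSupport.of_support_subset_isCompact (hψ.2.image continuous_fst) ?_
    intro x hx
    exact ⟨(x, η x), subset_tsupport _ hx, rfl⟩
  refine (hf.integrable_smul_left_of_hasCompactSupport
    (by fun_prop : Continuous fun x => ψ (x, η x)) hc).congr (.of_forall fun x => ?_)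
  simp [mul_comm]

lemma HasWeakGrad.add_const_mul {Ω : Set (Pt d)} {φ₁ φ₂ : Pt d → ℝ} {w₁ w₂ : Pt d → Pt d}
    (h₁ : HasWeakGrad Ω φ₁ w₁) (c : ℝ) (h₂ : HasWeakGrad Ω φ₂ w₂) :
    HasWeakGrad Ω (fun z => φ₁ z + c * φ₂ z) (fun z => w₁ z + c • w₂ z) where
  memLp K hK := (h₁.memLp K hK).add ((h₂.memLp K hK).const_mul c)
  memLp_grad K hK := (h₁.memLp_grad K hK).add ((h₂.memLp_grad K hK).const_smul c)
  integral_eq ψ hψ hs := by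
    simp only [add_smul, smul_add, mul_smul, smul_comm (_ : ℝ) c]
    rw [integral_add (integrable_smul_grad h₁.memLp hψ)
        ((integrable_smul_grad h₂.memLp hψ).fun_smul c),
      integral_add (integrable_test_smul h₁.memLp_grad hψ)
        ((integrable_test_smul h₂.memLp_grad hψ).fun_smul c),
      integral_smul, integral_smul, h₁.integral_eq ψ hψ hs, h₂.integral_eq ψ hψ hs, smul_neg]
    abel

lemma IsTrace.add_const_mul {P : Phase} {η : Hor d → ℝ} {b : Rigid d} (hη : Continuous η)
    {φ₁ φ₂ : Pt d → ℝ} {w₁ w₂ : Pt d → Pt d} {f₁ f₂ : Hor d → ℝ}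
    (g₁ : HasWeakGrad (fluid P η b) φ₁ w₁) (g₂ : HasWeakGrad (fluid P η b) φ₂ w₂)
    (h₁ : IsTrace P η b φ₁ w₁ f₁) (c : ℝ) (h₂ : IsTrace P η b φ₂ w₂ f₂) :
    IsTrace P η b (fun z => φ₁ z + c * φ₂ z) (fun z => w₁ z + c • w₂ z)
      (fun x => f₁ x + c * f₂ x) := by
  refine ⟨h₁.1.add (h₂.1.smul c), fun ψ hψ hs => ?_⟩
  have e₁ : (fun z => (φ₁ z + c * φ₂ z) * (grad ψ z).2 + (w₁ z + c • w₂ z).2 * ψ z) = fun z =>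
      (φ₁ z * (grad ψ z).2 + (w₁ z).2 * ψ z) + c * (φ₂ z * (grad ψ z).2 + (w₂ z).2 * ψ z) := by
    ext z
    simp only [Prod.snd_add, Prod.smul_snd, smul_eq_mul]
    ring
  have e₂ : (fun x => (f₁ x + c * f₂ x) * ψ (x, η x)) = fun x =>
      f₁ x * ψ (x, η x) + c * (f₂ x * ψ (x, η x)) := by
    ext x
    ring
  rw [e₁, e₂, integral_add (g₁.integrable_trace_integrand hψ)
      ((g₂.integrable_trace_integrand hψ).const_mul c),
    integral_add (integrable_mul_interface hη h₁.1 hψ)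
      ((integrable_mul_interface hη h₂.1 hψ).const_mul c),
    integral_const_mul, integral_const_mul, h₁.2 ψ hψ hs, h₂.2 ψ hψ hs]
  ring

/-! ### Vertical sweeping of test functions -/

/-- The point reached from `z` after moving by `s` in the vertical direction that leads from the
phase to the interface. -/
def ascend (P : Phase) (s : ℝ) (z : Pt d) : Pt d := (z.1, z.2 + P.sign * s)

@[simp] lemma ascend_fst (P : Phase) (s : ℝ) (z : Pt d) : (ascend P s z).1 = z.1 := rfl

@[simp] lemma ascend_snd (P : Phase) (s : ℝ) (z : Pt d) :
    (ascend P s z).2 = z.2 + P.sign * s := rfl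

lemma ascend_ascend (P : Phase) (s t : ℝ) (z : Pt d) :
    ascend P s (ascend P t z) = ascend P (s + t) z := by
  ext <;> simp; ring

@[simp] lemma ascend_zero (P : Phase) (z : Pt d) : ascend P 0 z = z := by
  ext <;> simp

lemma ascend_eq_add (P : Phase) (s : ℝ) (z : Pt d) : ascend P s z = z + (0, P.sign * s) := by
  ext <;> simp

lemma continuous_ascend (P : Phase) : Continuous fun p : Pt d × ℝ => ascend P p.2 p.1 := by
  unfold ascend
  fun_prop

/-- Points of a compact set leave the fluid domain in bounded time. -/
lemma exists_exit_time (P : Phase) {η : Hor d → ℝ} (b : Rigid d) (hη : Continuous η)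
    {K : Set (Pt d)} (hK : IsCompact K) :
    ∃ M : ℝ, 0 < M ∧ ∀ z ∈ K, ∀ s, M ≤ s → ascend P s z ∉ fluid P η b := by
  -- `C` bounds the vertical distance from points of `K` to the interface.
  obtain ⟨C, hC⟩ := hK.exists_bound_of_continuousOn
    (f := fun z : Pt d => P.sign * η z.1 - P.sign * z.2) (by fun_prop)
  refine ⟨max C 1, by positivity, fun z hz s hs h => ?_⟩
  have h1 := (mem_fluid_iff.1 h).1
  have h2 := (le_abs_self _).trans (hC z hz)
  have h3 := (le_max_left C 1).trans hs
  simp only [ascend_fst, ascend_snd, mul_add, ← mul_assoc, P.sign_mul_self, one_mul] at h1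
  linarith

/-- The integral of `χ` over the vertical segment of length `M` that ends at `z`. -/
def sweep (P : Phase) (M : ℝ) (χ : Pt d → ℝ) (z : Pt d) : ℝ :=
  ∫ s in Ioo 0 M, χ (ascend P (-s) z)

/-- In the vertical variable the sweep is the convolution of `χ` with the indicator of an interval,
while `x` is a parameter; smoothness is inherited from `χ`. -/
lemma contDiff_sweep (P : Phase) (M : ℝ) {χ : Pt d → ℝ} (hχ : IsTest χ) :
    ContDiff ℝ ∞ (sweep P M χ) := by
  let f : ℝ → ℝ := indicator {t | P.sign * t ∈ Ioo 0 M} 1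
  have hf : LocallyIntegrable f := by
    refine (locallyIntegrable_const (1 : ℝ)).indicator ?_
    exact measurableSet_Ioo.preimage (by fun_prop : Measurable fun t : ℝ => P.sign * t)
  have h := contDiffOn_convolution_right_with_param (𝕜 := ℝ) (n := ⊤) (ContinuousLinearMap.mul ℝ ℝ)
    (f := f) (g := fun (x : Hor d) y => χ (x, y)) (s := univ) (k := Prod.snd '' tsupport χ)
    (μ := volume) isOpen_univ (hχ.2.image continuous_snd) ?_ hf ?_
  · rw [univ_prod_univ, contDiffOn_univ] at h
    convert! h using 1
    ext z
    simp only [sweep, ascend, convolution, f, ContinuousLinearMap.mul_apply']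
    rw [← integral_indicator measurableSet_Ioo]
    cases P with
    | lower =>
      congr 1
      ext s
      by_cases hs : s ∈ Ioo 0 M <;> simp [indicator, Phase.sign, sub_eq_add_neg] at hs ⊢
    | upper =>
      rw [← integral_neg_eq_self]
      congr 1
      ext s
      by_cases hs : -s ∈ Ioo 0 M <;> simp [indicator, Phase.sign, sub_eq_add_neg] at hs ⊢
  · intro x y _ hy
    by_contra hne
    exact hy ⟨(x, y), subset_tsupport _ hne, rfl⟩
  · exact hχ.1.contDiffOn

lemma tsupport_sweep_subset (P : Phase) (M : ℝ) {χ : Pt d → ℝ} (hχ : IsTest χ) :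
    IsCompact ((fun p : Pt d × ℝ => ascend P p.2 p.1) '' (tsupport χ ×ˢ Icc 0 M)) ∧
      tsupport (sweep P M χ) ⊆
        (fun p : Pt d × ℝ => ascend P p.2 p.1) '' (tsupport χ ×ˢ Icc 0 M) := by
  have hc : IsCompact ((fun p : Pt d × ℝ => ascend P p.2 p.1) '' (tsupport χ ×ˢ Icc 0 M)) :=
    (hχ.2.prod isCompact_Icc).image (continuous_ascend P)
  refine ⟨hc, closure_minimal ?_ hc.isClosed⟩
  intro z hz
  by_contra hne
  refine hz (setIntegral_eq_zero_of_forall_eq_zero fun s hs => ?_)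
  by_contra h
  refine hne ⟨(ascend P (-s) z, s), ⟨subset_tsupport _ h, hs.1.le, hs.2.le⟩, ?_⟩
  simp [ascend_ascend]

lemma isTest_sweep (P : Phase) (M : ℝ) {χ : Pt d → ℝ} (hχ : IsTest χ) : IsTest (sweep P M χ) :=
  ⟨contDiff_sweep P M hχ,
    (tsupport_sweep_subset P M hχ).1.of_isClosed_subset (isClosed_tsupport _)
      (tsupport_sweep_subset P M hχ).2⟩

/-- Along a vertical line the sweep is a difference of two primitives of `χ`, so only the endpoint
values survive. In the application `M` is an exit time, which removes the value at the far endpoint.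
-/
lemma fderiv_sweep_vert (P : Phase) {M : ℝ} (hM : 0 ≤ M) {χ : Pt d → ℝ} (hχ : IsTest χ)
    (z : Pt d) :
    fderiv ℝ (sweep P M χ) z (0, 1) = P.sign * (χ z - χ (ascend P (-M) z)) := by
  have h1 : fderiv ℝ (sweep P M χ) z (0, 1) = deriv (fun y => sweep P M χ (z.1, y)) z.2 := by
    rw [(hasFDerivAt_snd (isTest_sweep P M hχ) z).hasDerivAt.deriv]
    simp
  have hχc := hχ.1.continuous
  have hc : Continuous fun y => χ (z.1, y) := by fun_prop
  have key : ∀ q : ℝ, HasDerivAt (fun y => ∫ t in (0 : ℝ)..y + q, χ (z.1, t))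
      (χ (z.1, z.2 + q)) z.2 := fun q => 
    (hc.integral_hasStrictDerivAt 0 (z.2 + q)).hasDerivAt.comp_add_const z.2 q
  rw [h1]
  cases P with
  | lower =>
    have e : (fun y => sweep Phase.lower M χ (z.1, y)) = fun y =>
        (∫ t in (0 : ℝ)..y + 0, χ (z.1, t)) - ∫ t in (0 : ℝ)..y + -M, χ (z.1, t) := by
      ext y
      rw [intervalIntegral.integral_interval_sub_left (hc.intervalIntegrable _ _)
        (hc.intervalIntegrable _ _), sweep, ← integral_Ioc_eq_integral_Ioo,
        ← intervalIntegral.integral_of_le hM]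
      simp only [ascend, Phase.sign, one_mul, ← sub_eq_add_neg]
      rw [intervalIntegral.integral_comp_sub_left (fun t => χ (z.1, t))]
      simp
    rw [e, ((key 0).fun_sub (key (-M))).deriv]
    simp [ascend, Phase.sign]
  | upper =>
    have e : (fun y => sweep Phase.upper M χ (z.1, y)) = fun y =>
        (∫ t in (0 : ℝ)..y + M, χ (z.1, t)) - ∫ t in (0 : ℝ)..y + 0, χ (z.1, t) := by
      ext y
      rw [intervalIntegral.integral_interval_sub_left (hc.intervalIntegrable _ _)
        (hc.intervalIntegrable _ _), sweep, ← integral_Ioc_eq_integral_Ioo,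
        ← intervalIntegral.integral_of_le hM]
      simp only [ascend, Phase.sign, neg_mul, one_mul, neg_neg]
      rw [intervalIntegral.integral_comp_add_left (fun t => χ (z.1, t))]
    rw [e, ((key M).fun_sub (key 0)).deriv]
    simp [ascend, Phase.sign]

/-- Sweeping towards the interface does not reach the rigid boundary. -/
lemma disjoint_tsupport_sweep {P : Phase} {η : Hor d → ℝ} {b : Rigid d} (M : ℝ) {χ : Pt d → ℝ}
    (hχ : IsTest χ) (hs : tsupport χ ⊆ fluid P η b) :
    Disjoint (tsupport (sweep P M χ)) (rigidSet b) := by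
  refine Set.disjoint_left.2 fun z hz hr => ?_
  obtain ⟨⟨z', s⟩, ⟨hz', hs0, -⟩, rfl⟩ := (tsupport_sweep_subset P M hχ).2 hz
  obtain ⟨β, hβ, h⟩ := hr
  have h1 := (mem_fluid_iff.1 (hs hz')).2 β hβ
  simp only [ascend_fst, ascend_snd] at h
  simp only at hs0
  rw [← h, mul_add, ← mul_assoc, P.sign_mul_self] at h1
  linarith

section

/-! ### The potential obtained by vertical integration from the interface -/

/-- The primitive of `W` in the vertical direction that vanishes at the interface, provided `W` is
extended by zero beyond it. -/
def potential (P : Phase) (W : Pt d → ℝ) (z : Pt d) : ℝ :=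
  -P.sign * ∫ s in Ioi 0, W (ascend P s z)

lemma sq_integral_le {α : Type*} [MeasurableSpace α] {ν : Measure α} [IsFiniteMeasure ν]
    {g : α → ℝ} (hm : AEStronglyMeasurable g ν) (hg : Integrable (fun s => g s ^ 2) ν) :
    (∫ s, g s ∂ν) ^ 2 ≤ ν.real univ * ∫ s, g s ^ 2 ∂ν := by
  have hg1 : Integrable g ν := ((memLp_two_iff_integrable_sq hm).2 hg).integrable (by norm_num)
  rcases (measureReal_nonneg (μ := ν) (s := univ)).eq_or_lt with h0 | h0
  · have : ν = 0 := by
      rwa [eq_comm, measureReal_eq_zero_iff, Measure.measure_univ_eq_zero] at h0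
    simp [this]
  set L := ν.real univ
  set m := ∫ s, g s ∂ν
  -- Cauchy-Schwarz against the constant function: the right-hand side is `L` times `L * ∫ g² - m²`,
  -- and the left-hand side is nonnegative.
  have h1 : ∫ s, (L * g s - m) ^ 2 ∂ν = L ^ 2 * (∫ s, g s ^ 2 ∂ν) - 2 * L * m * m + m ^ 2 * L := by
    have e : (fun s => (L * g s - m) ^ 2) = fun s =>
        (L ^ 2 * g s ^ 2 - 2 * L * m * g s) + m ^ 2 := by
      ext s; ring
    rw [e, integral_add (f := fun s => L ^ 2 * g s ^ 2 - 2 * L * m * g s)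
        ((hg.const_mul _).sub (hg1.const_mul _)) (integrable_const _),
      integral_sub (hg.const_mul _) (hg1.const_mul _), integral_const_mul, integral_const_mul,
      integral_const, smul_eq_mul]
    ring
  have h2 : 0 ≤ ∫ s, (L * g s - m) ^ 2 ∂ν := integral_nonneg fun s => sq_nonneg _
  rw [h1] at h2
  have h3 : 0 ≤ L * (L * (∫ s, g s ^ 2 ∂ν) - m ^ 2) := by linarith
  have := nonneg_of_mul_nonneg_right h3 h0
  linarith

/-- The map is a shear whose action on each slice is a translation. It transports square
integrability from `z` to the pair `(s, z)`, as the applications of Fubini's theorem require. -/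
lemma measurePreserving_ascend (P : Phase) (ν : Measure ℝ) [SFinite ν] {t : ℝ → ℝ}
    (ht : Measurable t) :
    MeasurePreserving (fun p : ℝ × Pt d => (p.1, ascend P (t p.1) p.2)) (ν.prod volume)
      (ν.prod volume) := by
  refine (MeasurePreserving.id ν).skew_product (g := fun s z => ascend P (t s) z) ?_ ?_
  · unfold Function.uncurry ascend
    fun_prop
  · refine .of_forall fun s => ?_
    simp only [ascend_eq_add]
    exact (measurePreserving_add_right volume _).map_eq

lemma integrable_sq_ascend (P : Phase) (ν : Measure ℝ) [IsFiniteMeasure ν] {t : ℝ → ℝ}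
    (ht : Measurable t) {W : Pt d → ℝ} (hW : MemLp W 2) :
    Integrable (fun p : ℝ × Pt d => W (ascend P (t p.1) p.2) ^ 2) (ν.prod volume) := by
  have h : Integrable (fun p : ℝ × Pt d => W p.2 ^ 2) (ν.prod volume) := hW.integrable_sq.comp_snd ν
  exact (measurePreserving_ascend P ν ht).integrable_comp_of_integrable h

lemma stronglyMeasurable_ascend (P : Phase) {t : ℝ → ℝ} (ht : Measurable t) {W : Pt d → ℝ}
    (hW : StronglyMeasurable W) :
    StronglyMeasurable fun p : ℝ × Pt d => W (ascend P (t p.1) p.2) := by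
  refine hW.comp_measurable ?_
  unfold ascend
  fun_prop

lemma integrable_mul_ascend (P : Phase) (ν : Measure ℝ) [IsFiniteMeasure ν] {t : ℝ → ℝ}
    (ht : Measurable t) {A B : Pt d → ℝ} (hA : MemLp A 2) (hB : MemLp B 2)
    (hA' : StronglyMeasurable A) (hB' : StronglyMeasurable B) :
    Integrable (fun p : ℝ × Pt d => A (ascend P (t p.1) p.2) * B p.2) (ν.prod volume) := by
  have h : Integrable (fun p : ℝ × Pt d => B p.2 ^ 2) (ν.prod volume) := hB.integrable_sq.comp_snd ν
  refine ((integrable_sq_ascend P ν ht hA).add h).mono' ?_ (.of_forall fun p => ?_)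
  · exact ((stronglyMeasurable_ascend P ht hA').mul
      (hB'.comp_measurable measurable_snd)).aestronglyMeasurable
  · simp only [Real.norm_eq_abs, Pi.add_apply]
    rw [abs_le]
    constructor <;> nlinarith [sq_nonneg (A (ascend P (t p.1) p.2) + B p.2),
      sq_nonneg (A (ascend P (t p.1) p.2) - B p.2), sq_nonneg (A (ascend P (t p.1) p.2)),
      sq_nonneg (B p.2)]

variable {P : Phase} {η : Hor d → ℝ} {b : Rigid d} {W : Pt d → ℝ}

lemma setIntegral_Ioi_eq_Ioo {g : ℝ → ℝ} {M : ℝ} (h : ∀ s, M ≤ s → g s = 0) :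
    ∫ s in Ioi 0, g s = ∫ s in Ioo 0 M, g s := by
  refine (setIntegral_eq_of_subset_of_forall_sdiff_eq_zero measurableSet_Ioi
    (fun s hs => hs.1) fun s hs => h s ?_)
  by_contra hlt
  exact hs.2 ⟨hs.1, not_le.1 hlt⟩

lemma potential_eq_of_exit (h0 : ∀ z ∉ fluid P η b, W z = 0) {M : ℝ} {z : Pt d}
    (hz : ∀ s, M ≤ s → ascend P s z ∉ fluid P η b) :
    potential P W z = -P.sign * ∫ s in Ioo 0 M, W (ascend P s z) := by
  rw [potential, setIntegral_Ioi_eq_Ioo fun s hs => h0 _ (hz s hs)]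

/-- A local Poincaré inequality: above `K` the vertical rays leave the fluid before time `M`, so the
potential is an integral over a bounded interval, and Cauchy-Schwarz controls its square by that of
`W`. -/
lemma memLp_potential (hη : Continuous η) (hb : RigidLipschitz b) (hW : MemLp W 2)
    (hW' : StronglyMeasurable W) (h0 : ∀ z ∉ fluid P η b, W z = 0) {K : Set (Pt d)}
    (hK : IsCompact K) : MemLp (potential P W) 2 (volume.restrict (fluid P η b ∩ K)) := by
  obtain ⟨M, -, hM⟩ := exists_exit_time P b hη hK
  have hΩK : MeasurableSet (fluid P η b ∩ K) :=
    (isOpen_fluid P hη hb).measurableSet.inter hK.measurableSet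
  have hsm := stronglyMeasurable_ascend P measurable_id hW'
  have hi := integrable_sq_ascend P (volume.restrict (Ioo 0 M)) measurable_id hW
  have hpm : StronglyMeasurable fun z => -P.sign * ∫ s in Ioo 0 M, W (ascend P s z) :=
    (hsm.integral_prod_left' (μ := volume.restrict (Ioo 0 M))).const_mul _
  refine MemLp.ae_eq (f := fun z => -P.sign * ∫ s in Ioo 0 M, W (ascend P s z)) ?_ ?_
  · filter_upwards [ae_restrict_mem hΩK] with z hz
    exact (potential_eq_of_exit h0 (hM z hz.2)).symm
  · refine MemLp.restrict _ ((memLp_two_iff_integrable_sq hpm.aestronglyMeasurable).2 ?_)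
    refine (hi.integral_prod_right.const_mul ((volume.restrict (Ioo 0 M)).real univ)).mono'
      (hpm.pow 2).aestronglyMeasurable ?_
    filter_upwards [hi.prod_left_ae] with z hz
    rw [Real.norm_of_nonneg (sq_nonneg _), mul_pow, neg_sq, sq P.sign, P.sign_mul_self, one_mul]
    exact sq_integral_le (hsm.comp_measurable measurable_prodMk_right).aestronglyMeasurable hz

/-- Fubini's theorem: vertical integration and sweeping are adjoint to each other. -/
lemma setIntegral_potential_mul (hη : Continuous η) (hb : RigidLipschitz b) (hW : MemLp W 2)
    (hW' : StronglyMeasurable W) (h0 : ∀ z ∉ fluid P η b, W z = 0) {h : Pt d → ℝ}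
    (hh : IsTest h) {M : ℝ}
    (hM : ∀ z ∈ tsupport h, ∀ s, M ≤ s → ascend P s z ∉ fluid P η b) :
    ∫ z in fluid P η b, potential P W z * h z
      = -P.sign * ∫ z in fluid P η b, W z * sweep P M ((fluid P η b).indicator h) z := by
  have hΩ : MeasurableSet (fluid P η b) := (isOpen_fluid P hη hb).measurableSet
  set H := (fluid P η b).indicator h with hH
  have hHm : StronglyMeasurable H := hh.1.continuous.stronglyMeasurable.indicator hΩ
  have hHL : MemLp H 2 := (hh.1.continuous.memLp_of_hasCompactSupport hh.2).indicator hΩ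
  set ν : Measure ℝ := volume.restrict (Ioo 0 M)
  have hG := integrable_mul_ascend P ν measurable_id hW hHL hW' hHm
  have hG' := integrable_mul_ascend P ν measurable_neg hHL hW hHm hW'
  calc ∫ z in fluid P η b, potential P W z * h z
      = ∫ z, -P.sign * ∫ s, W (ascend P s z) * H z ∂ν := by
        rw [← integral_indicator hΩ]
        congr 1
        ext z
        by_cases hz : z ∈ fluid P η b
        · rw [indicator_of_mem hz, integral_mul_const, hH, indicator_of_mem hz, ← mul_assoc]
          by_cases hzs : z ∈ tsupport h
          · rw [potential_eq_of_exit h0 (hM z hzs)]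
          · rw [image_eq_zero_of_notMem_tsupport hzs, mul_zero, mul_zero]
        · rw [indicator_of_notMem hz, hH, indicator_of_notMem hz]
          simp
    _ = -P.sign * ∫ s, ∫ z, W (ascend P s z) * H z ∂volume ∂ν := by
        rw [integral_const_mul, integral_integral_swap]
        exact hG.swap
    _ = -P.sign * ∫ s, ∫ z, H (ascend P (-s) z) * W z ∂volume ∂ν := by
        congr 2
        ext s
        rw [← integral_add_right_eq_self (fun z => H (ascend P (-s) z) * W z) (0, P.sign * s)]
        congr 1
        ext z
        rw [← ascend_eq_add, ascend_ascend, neg_add_cancel, ascend_zero, mul_comm]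
    _ = -P.sign * ∫ z, ∫ s, H (ascend P (-s) z) * W z ∂ν := by
        rw [integral_integral_swap hG']
    _ = _ := by
        congr 1
        rw [← integral_indicator hΩ]
        congr 1
        ext z
        by_cases hz : z ∈ fluid P η b
        · rw [indicator_of_mem hz, integral_mul_const, mul_comm]
          rfl
        · rw [indicator_of_notMem hz, h0 z hz]
          simp

lemma setIntegral_Ioi_ascend (P : Phase) (z : Pt d) (k : ℝ → ℝ) :
    ∫ s in Ioi 0, k (ascend P (-s) z).2 = ∫ y in {y | P.sign * y < P.sign * z.2}, k y := by
  rw [← integral_indicator measurableSet_Ioi,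
    ← integral_indicator (measurableSet_lt (by fun_prop) (by fun_prop))]
  cases P with
  | lower =>
    conv_rhs => rw [← integral_sub_left_eq_self _ volume z.2]
    congr 1
    ext s
    simp [indicator, Phase.sign, sub_eq_add_neg]
  | upper =>
    conv_rhs => rw [← integral_add_left_eq_self _ z.2]
    congr 1
    ext s
    simp [indicator, Phase.sign]

/-- By adjointness, the integral of `potential P W` against the vertical derivative of `ψ` moves to
a sweep of that derivative, cut off outside the fluid. The sweep gives back `P.sign * ψ` inside the
fluid, as `ψ` vanishes on the rigid boundary, and the two terms of the trace identity cancel. -/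
lemma isTrace_potential (hη : Continuous η) (hb : RigidLipschitz b) {w : Pt d → Pt d}
    (hW : MemLp W 2) (hW' : StronglyMeasurable W) (h0 : ∀ z ∉ fluid P η b, W z = 0)
    (hw : ∀ᵐ z ∂volume.restrict (fluid P η b), (w z).2 = W z) :
    IsTrace P η b (potential P W) w (fun _ => 0) := by
  have hΩ : MeasurableSet (fluid P η b) := (isOpen_fluid P hη hb).measurableSet
  refine ⟨locallyIntegrable_zero, fun ψ hψ hd => ?_⟩
  obtain ⟨M, -, hM⟩ := exists_exit_time P b hη hψ.2
  have hh := hψ.fderiv_apply (0, 1)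
  have hsub := tsupport_fderiv_apply_subset (ψ := ψ) (0, 1)
  have h1 := setIntegral_potential_mul hη hb hW hW' h0 hh fun z hz => hM z (hsub hz)
  have h2 : ∀ z ∈ fluid P η b,
      sweep P M ((fluid P η b).indicator fun z => fderiv ℝ ψ z (0, 1)) z = P.sign * ψ z := by
    intro z hz
    -- A point reached from `z` by going back for a time at least `M` is not in the support of `ψ`:
    -- otherwise its ascent would have left the fluid by then, but it returns to `z`. Hence `(0, M)`
    -- may be replaced by `(0, ∞)`.
    have e1 : ∀ s, M ≤ s →
        (fluid P η b).indicator (fun z => fderiv ℝ ψ z (0, 1)) (ascend P (-s) z) = 0 := by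
      intro s hs
      by_contra hne
      have h3 : ascend P (-s) z ∈ tsupport ψ := hsub (subset_tsupport _ fun h => hne (by
        simp only [indicator, h, ite_self]))
      refine hM _ h3 s hs ?_
      rwa [ascend_ascend, add_neg_cancel, ascend_zero]
    have hz' := mem_fluid_iff.1 hz
    rw [sweep, ← setIntegral_Ioi_eq_Ioo e1]
    refine (setIntegral_Ioi_ascend P z fun y =>
      (fluid P η b).indicator (fun z => fderiv ℝ ψ z (0, 1)) (z.1, y)).trans ?_
    have hc := setIntegral_column_deriv P hz'.2 (hψ.slice z.1).1 (hψ.slice z.1).2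
      fun β hβ => image_eq_zero_of_notMem_tsupport fun h => hd.le_bot ⟨h, β, hβ, rfl⟩
    refine Eq.trans ?_ hc
    rw [← integral_indicator (measurableSet_lt (by fun_prop) (by fun_prop)),
      ← integral_indicator (measurableSet_column _ _ _ _)]
    congr 1
    ext y
    have h3 : deriv (fun y => ψ (z.1, y)) y = fderiv ℝ ψ (z.1, y) (0, 1) := by
      rw [(hasFDerivAt_snd hψ (z.1, y)).hasDerivAt.deriv]
      simp
    by_cases hy : P.sign * y < P.sign * z.2
    · have := hy.trans hz'.1
      simp [indicator, column, mem_fluid_iff, hy, this, h3]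
    · simp [indicator, column, hy]
  have hpot : ∀ K : Set (Pt d), IsCompact K →
      MemLp (potential P W) 2 (volume.restrict (fluid P η b ∩ K)) :=
    fun K hK => memLp_potential hη hb hW hW' h0 hK
  have i1 : IntegrableOn (fun z => potential P W z * (grad ψ z).2) (fluid P η b) :=
    (integrable_smul_grad hpot hψ).snd
  have i2 : IntegrableOn (fun z => ψ z * W z) (fluid P η b) :=
    integrable_test_smul (fun K _ => hW.restrict _) hψ
  have e3 : ∫ z in fluid P η b, (potential P W z * (grad ψ z).2 + (w z).2 * ψ z)
      = ∫ z in fluid P η b, (potential P W z * (grad ψ z).2 + ψ z * W z) :=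
    integral_congr_ae (by
      filter_upwards [hw] with z hz
      rw [hz, mul_comm (W z)])
  have e4 : ∫ z in fluid P η b,
        W z * sweep P M ((fluid P η b).indicator fun z => fderiv ℝ ψ z (0, 1)) z
      = ∫ z in fluid P η b, P.sign * (ψ z * W z) :=
    setIntegral_congr_fun hΩ fun z hz => by
      rw [h2 z hz]
      ring
  rw [e3, integral_add i1 i2]
  simp only [grad_snd hψ]
  rw [h1, e4, integral_const_mul, ← mul_assoc, neg_mul, P.sign_mul_self]
  simp

end

section

/-! ### Existence of the variational solution -/

/-- Square integrable vector fields as elements of a Hilbert space. -/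
def toL2 {Ω : Set (Pt d)} {w : Pt d → Pt d} (hw : MemLp w 2 (volume.restrict Ω)) :
    Lp (WithLp 2 (Pt d)) 2 (volume.restrict Ω) :=
  MemLp.toLp (fun z => WithLp.toLp 2 (w z))
    (((WithLp.prodContinuousLinearEquiv 2 ℝ (Hor d) ℝ).symm :
      Pt d →L[ℝ] WithLp 2 (Pt d)).comp_memLp' hw)

lemma inner_toL2 {Ω : Set (Pt d)} {a c : Pt d → Pt d} (ha : MemLp a 2 (volume.restrict Ω))
    (hc : MemLp c 2 (volume.restrict Ω)) :
    inner ℝ (toL2 ha) (toL2 hc) = ∫ z in Ω, dot (a z) (c z) := by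
  rw [L2.inner_def]
  refine integral_congr_ae ?_
  filter_upwards [MemLp.coeFn_toLp (((WithLp.prodContinuousLinearEquiv 2 ℝ (Hor d) ℝ).symm :
      Pt d →L[ℝ] WithLp 2 (Pt d)).comp_memLp' ha),
    MemLp.coeFn_toLp (((WithLp.prodContinuousLinearEquiv 2 ℝ (Hor d) ℝ).symm :
      Pt d →L[ℝ] WithLp 2 (Pt d)).comp_memLp' hc)] with z h1 h2
  have e1 : (toL2 ha : Pt d → WithLp 2 (Pt d)) z = WithLp.toLp 2 (a z) := h1
  have e2 : (toL2 hc : Pt d → WithLp 2 (Pt d)) z = WithLp.toLp 2 (c z) := h2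
  rw [e1, e2, WithLp.prod_inner_apply]
  simp [dot, mul_comm]

lemma toL2_sub {Ω : Set (Pt d)} {a c : Pt d → Pt d} (ha : MemLp a 2 (volume.restrict Ω))
    (hc : MemLp c 2 (volume.restrict Ω)) : toL2 (ha.sub hc) = toL2 ha - toL2 hc :=
  MemLp.toLp_sub _ _

lemma exists_toL2_eq {Ω : Set (Pt d)} (X : Lp (WithLp 2 (Pt d)) 2 (volume.restrict Ω)) :
    ∃ (w : Pt d → Pt d) (hw : MemLp w 2 (volume.restrict Ω)), toL2 hw = X := by
  refine ⟨fun z => WithLp.ofLp (X z), ((WithLp.prodContinuousLinearEquiv 2 ℝ (Hor d) ℝ :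
    WithLp 2 (Pt d) →L[ℝ] Pt d).comp_memLp' (Lp.memLp X)), ?_⟩
  exact Lp.toLp_coeFn X (Lp.memLp X)

/-- Gradients of finite energy functions with zero trace are characterized by orthogonality to
these fields. -/
def corrector (P : Phase) (M : ℝ) (ψ : Pt d → ℝ) (a z : Pt d) : Pt d :=
  sweep P M (fun z => fderiv ℝ ψ z a) z • eVert - (P.sign * ψ z) • a

lemma dot_corrector (P : Phase) (M : ℝ) (ψ : Pt d → ℝ) (a z w : Pt d) :
    dot w (corrector P M ψ a z)
      = w.2 * sweep P M (fun z => fderiv ℝ ψ z a) z - P.sign * (ψ z * dot w a) := by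
  simp only [dot, corrector, eVert, Prod.fst_sub, Prod.snd_sub, Prod.smul_fst, Prod.smul_snd,
    smul_zero, zero_sub, inner_neg_right, inner_smul_right, smul_eq_mul]
  ring

lemma memLp_corrector (P : Phase) (M : ℝ) {ψ : Pt d → ℝ} (hψ : IsTest ψ) (a : Pt d) :
    MemLp (corrector P M ψ a) 2 := by
  have h := isTest_sweep P M (hψ.fderiv_apply a)
  refine MemLp.sub ?_ ?_
  · exact (h.1.continuous.smul continuous_const).memLp_of_hasCompactSupport h.2.smul_right
  · refine Continuous.memLp_of_hasCompactSupport ?_ ?_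
    · exact (continuous_const.mul hψ.1.continuous).smul continuous_const
    · exact (hψ.2.mul_left (f := fun _ => P.sign)).smul_right

lemma integrable_snd_mul_test {Ω : Set (Pt d)} {w : Pt d → Pt d}
    (hw : MemLp w 2 (volume.restrict Ω)) {ψ : Pt d → ℝ} (hψ : IsTest ψ) :
    IntegrableOn (fun z => (w z).2 * ψ z) Ω :=
  MemLp.integrable_mul (p := 2) (q := 2) hw.snd
    ((hψ.1.continuous.memLp_of_hasCompactSupport hψ.2).restrict _)

lemma integrable_test_mul_dot {Ω : Set (Pt d)} {w : Pt d → Pt d}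
    (hw : MemLp w 2 (volume.restrict Ω)) {ψ : Pt d → ℝ} (hψ : IsTest ψ) (a : Pt d) :
    IntegrableOn (fun z => ψ z * dot (w z) a) Ω := by
  have h : MemLp (fun z => ψ z • a) 2 :=
    (hψ.1.continuous.smul continuous_const).memLp_of_hasCompactSupport hψ.2.smul_right
  refine (integrable_dot hw (h.restrict _)).congr (.of_forall fun z => ?_)
  simp only [dot, Prod.smul_fst, Prod.smul_snd, inner_smul_right, smul_eq_mul]
  ring

variable {P : Phase} {η : Hor d → ℝ} {b : Rigid d}

/-- The sweep of the derivative of `ψ` in direction `a` stays away from the rigid boundary but may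
cross the interface, so it is a legitimate test function for the zero trace. Inside the fluid its
vertical derivative is `P.sign` times the swept derivative; the identity for the weak gradient in
direction `a` then eliminates `v`. -/
lemma integral_dot_corrector_of_isTrace_zero (hη : Continuous η) (hb : RigidLipschitz b)
    {v : Pt d → ℝ} {w : Pt d → Pt d}
    (hv : FiniteEnergy (fluid P η b) v w) (ht : IsTrace P η b v w (fun _ => 0)) {ψ : Pt d → ℝ}
    (hψ : IsTest ψ) (hs : tsupport ψ ⊆ fluid P η b) (a : Pt d) {M : ℝ} (hM0 : 0 ≤ M)
    (hM : ∀ z ∈ tsupport ψ, ∀ s, M ≤ s → ascend P s z ∉ fluid P η b) :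
    ∫ z in fluid P η b, dot (w z) (corrector P M ψ a z) = 0 := by
  have hχ := hψ.fderiv_apply a
  have hsub := tsupport_fderiv_apply_subset (ψ := ψ) a
  have hS := isTest_sweep P M hχ
  have h1 := ht.2 _ hS (disjoint_tsupport_sweep M hχ (hsub.trans hs))
  have h2 := (hasWeakGrad_iff hv.1.memLp hv.1.memLp_grad).1 hv.1 ψ hψ hs a
  have e : ∫ z in fluid P η b, (v z * (grad (sweep P M fun z => fderiv ℝ ψ z a) z).2
        + (w z).2 * sweep P M (fun z => fderiv ℝ ψ z a) z)
      = ∫ z in fluid P η b, (P.sign * (v z * fderiv ℝ ψ z a)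
        + (w z).2 * sweep P M (fun z => fderiv ℝ ψ z a) z) :=
    setIntegral_congr_fun (isOpen_fluid P hη hb).measurableSet fun z hz => by
      -- If this point were in the support of `ψ`, ascending by the exit time `M` would lead out of
      -- the fluid, whereas it leads back to `z`.
      have h0 : fderiv ℝ ψ (ascend P (-M) z) a = 0 := by
        by_contra hne
        refine hM _ (hsub (subset_tsupport (fun z => fderiv ℝ ψ z a) hne)) M le_rfl ?_
        rwa [ascend_ascend, add_neg_cancel, ascend_zero]
      beta_reduce
      rw [grad_snd hS, fderiv_sweep_vert P hM0 hχ, h0]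
      ring
  have i1 : IntegrableOn (fun z => v z * fderiv ℝ ψ z a) (fluid P η b) := by
    refine (integrable_test_smul hv.1.memLp hχ).congr (.of_forall fun z => ?_)
    simp [mul_comm]
  have i2 := integrable_snd_mul_test hv.2 hS
  have i3 := integrable_test_mul_dot hv.2 hψ a
  rw [e, integral_add (i1.const_mul _) i2, integral_const_mul, h2] at h1
  simp only [dot_corrector]
  rw [integral_sub i2 (i3.const_mul _), integral_const_mul]
  simp only [zero_mul, integral_zero, mul_zero] at h1
  linarith

/-- The candidate is the vertical primitive of the last component of `w`, whose trace vanishes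
without any use of `h`. Adjointness of integration and sweeping turns the orthogonality to the
correctors into the weak gradient identity, one direction `a` at a time. -/
lemma exists_potential_of_integral_dot_corrector (hη : Continuous η) (hb : RigidLipschitz b)
    {w : Pt d → Pt d} (hw : MemLp w 2 (volume.restrict (fluid P η b)))
    (h : ∀ ψ : Pt d → ℝ, IsTest ψ → tsupport ψ ⊆ fluid P η b → ∀ (a : Pt d) (M : ℝ), 0 ≤ M →
      (∀ z ∈ tsupport ψ, ∀ s, M ≤ s → ascend P s z ∉ fluid P η b) →
      ∫ z in fluid P η b, dot (w z) (corrector P M ψ a z) = 0) :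
    ∃ v, FiniteEnergy (fluid P η b) v w ∧ IsTrace P η b v w (fun _ => 0) := by
  have hΩ : MeasurableSet (fluid P η b) := (isOpen_fluid P hη hb).measurableSet
  have hw2 : MemLp (fun z => (w z).2) 2 (volume.restrict (fluid P η b)) := hw.snd
  -- A strongly measurable representative, extended by zero outside the fluid, makes the integral
  -- over a vertical half-line stop at the interface.
  obtain ⟨W₀, hW₀, hae⟩ := hw2.1
  set W := (fluid P η b).indicator W₀ with hWdef
  have hW' : StronglyMeasurable W := hW₀.indicator hΩ
  have hW : MemLp W 2 := (memLp_indicator_iff_restrict hΩ).2 (hw2.ae_eq hae)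
  have h0 : ∀ z ∉ fluid P η b, W z = 0 := fun z hz => indicator_of_notMem hz _
  have hwW : ∀ᵐ z ∂volume.restrict (fluid P η b), (w z).2 = W z := by
    filter_upwards [hae, ae_restrict_mem hΩ] with z h1 h2
    rw [hWdef, indicator_of_mem h2]
    exact h1
  have hpot : ∀ K : Set (Pt d), IsCompact K →
      MemLp (potential P W) 2 (volume.restrict (fluid P η b ∩ K)) :=
    fun K hK => memLp_potential hη hb hW hW' h0 hK
  have hwK : ∀ K : Set (Pt d), IsCompact K → MemLp w 2 (volume.restrict (fluid P η b ∩ K)) :=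
    fun K _ => hw.mono_measure (Measure.restrict_mono inter_subset_left le_rfl)
  refine ⟨potential P W, ⟨(hasWeakGrad_iff hpot hwK).2 fun ψ hψ hs a => ?_, hw⟩,
    isTrace_potential hη hb hW hW' h0 hwW⟩
  obtain ⟨M, hM0, hM⟩ := exists_exit_time P b hη hψ.2
  have hχ := hψ.fderiv_apply a
  have hsub := tsupport_fderiv_apply_subset (ψ := ψ) a
  have hS := isTest_sweep P M hχ
  -- The cut-off in the adjointness formula is harmless here, because `ψ` is supported in the fluid.
  have hind : (fluid P η b).indicator (fun z => fderiv ℝ ψ z a) = fun z => fderiv ℝ ψ z a :=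
    indicator_eq_self.2 ((subset_tsupport _).trans (hsub.trans hs))
  have h1 := h ψ hψ hs a M hM0.le hM
  have i2 := integrable_snd_mul_test hw hS
  have i3 := integrable_test_mul_dot hw hψ a
  simp only [dot_corrector] at h1
  rw [integral_sub i2 (i3.const_mul _), integral_const_mul] at h1
  rw [setIntegral_potential_mul hη hb hW hW' h0 hχ fun z hz => hM z (hsub hz), hind]
  have e : ∫ z in fluid P η b, W z * sweep P M (fun z => fderiv ℝ ψ z a) z
      = ∫ z in fluid P η b, (w z).2 * sweep P M (fun z => fderiv ℝ ψ z a) z :=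
    integral_congr_ae (by
      filter_upwards [hwW] with z hz
      rw [hz])
  rw [e, sub_eq_zero.1 h1, ← mul_assoc, neg_mul, P.sign_mul_self, neg_mul, one_mul]

/-- A field orthogonal to the gradients of all finite energy functions with zero trace is
divergence free. -/
lemma NoFlux.divFree (hη : Continuous η) (hb : RigidLipschitz b)
    (hs : ∀ β ∈ b, ∀ x, P.sign * β x < P.sign * η x) {w : Pt d → Pt d} (hw : NoFlux P η b w) :
    DivFree (fluid P η b) w := by
  intro ψ hψ hsub
  have hd : ∀ z a, fderiv ℝ ψ z a = dot (grad ψ z) a := fun z a => (dot_grad hψ z a).symm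
  refine hw ψ (grad ψ) ⟨hasWeakGrad_of_contDiff hψ.1 (continuous_grad hψ) hd, ?_⟩ ?_
  · refine ((continuous_grad hψ).memLp_of_hasCompactSupport ?_).restrict _
    exact HasCompactSupport.intro hψ.2 fun z hz => grad_eq_zero hψ hz
  · have h := isTrace_of_contDiff hη hb hs hψ.1 hd
    have e : (fun x => ψ (x, η x)) = fun _ => 0 := by
      ext x
      refine image_eq_zero_of_notMem_tsupport fun hx => ?_
      exact lt_irrefl _ (mem_fluid_iff.1 (hsub hx)).1
    rwa [e] at h

/-- The variational solution exists for all Dirichlet data. -/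
theorem IsDirichletData.exists_isHarmonicExtension (hη : Continuous η) (hb : RigidLipschitz b)
    (hs : ∀ β ∈ b, ∀ x, P.sign * β x < P.sign * η x) {f : Hor d → ℝ}
    (hf : IsDirichletData P η b f) : ∃ φ w, IsHarmonicExtension P η b f φ w := by
  obtain ⟨φ₀, w₀, hφ₀, ht₀⟩ := hf
  let Q : Set (Lp (WithLp 2 (Pt d)) 2 (volume.restrict (fluid P η b))) :=
    {X | ∃ (ψ : Pt d → ℝ) (hψ : IsTest ψ) (a : Pt d) (M : ℝ), tsupport ψ ⊆ fluid P η b ∧ 0 ≤ M ∧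
      (∀ z ∈ tsupport ψ, ∀ s, M ≤ s → ascend P s z ∉ fluid P η b) ∧
      X = toL2 ((memLp_corrector P M hψ a).restrict _)}
  -- As an orthogonal complement `V` is closed, so orthogonal projection onto it is available; `hV`
  -- identifies it with the gradients of finite energy functions with zero trace.
  let V := (Submodule.span ℝ Q)ᗮ
  have hV : ∀ {w : Pt d → Pt d} (hw : MemLp w 2 (volume.restrict (fluid P η b))),
      toL2 hw ∈ V ↔ ∃ v, FiniteEnergy (fluid P η b) v w ∧ IsTrace P η b v w (fun _ => 0) := by
    intro w hw
    constructor
    · intro hmem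
      refine exists_potential_of_integral_dot_corrector hη hb hw fun ψ hψ hsub a M hM0 hM => ?_
      rw [← inner_toL2 hw ((memLp_corrector P M hψ a).restrict _)]
      have hQ : toL2 ((memLp_corrector P M hψ a).restrict _) ∈ Q :=
        ⟨ψ, hψ, a, M, hsub, hM0, hM, rfl⟩
      exact Submodule.inner_left_of_mem_orthogonal (Submodule.subset_span hQ) hmem
    · rintro ⟨v, hv, ht⟩
      rw [Submodule.mem_orthogonal']
      intro X hX
      induction hX using Submodule.span_induction with
      | mem X hX =>
        obtain ⟨ψ, hψ, a, M, hsub, hM0, hM, rfl⟩ := hX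
        rw [inner_toL2]
        exact integral_dot_corrector_of_isTrace_zero hη hb hv ht hψ hsub a hM0 hM
      | zero => exact inner_zero_right _
      | add X Y _ _ hX hY => rw [inner_add_right, hX, hY, add_zero]
      | smul c X _ hX => rw [inner_smul_right, hX, mul_zero]
  -- Dirichlet's principle: `w₁` is the projection of `w₀` onto `V`. The remainder `w₀ - w₁` is
  -- orthogonal to `V`, which is the no-flux condition, and subtracting `v` does not change the
  -- trace.
  obtain ⟨w₁, hw₁, hX⟩ := exists_toL2_eq (V.starProjection (toL2 hφ₀.2))
  obtain ⟨v, hv, ht⟩ := (hV hw₁).1 (by rw [hX]; exact V.starProjection_apply_mem _)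
  have hN : NoFlux P η b (fun z => w₀ z - w₁ z) := by
    intro v' w' hv' ht'
    have hmem := (hV hv'.2).2 ⟨v', hv', ht'⟩
    have := Submodule.inner_left_of_mem_orthogonal hmem
      (V.sub_starProjection_mem_orthogonal (toL2 hφ₀.2))
    rw [← hX, ← toL2_sub, inner_toL2] at this
    exact this
  refine ⟨fun z => φ₀ z - v z, fun z => w₀ z - w₁ z, ⟨hφ₀.1.sub hv.1, hφ₀.2.sub hw₁⟩,
    hN.divFree hη hb hs, ?_, hN⟩
  have := ht₀.add_const_mul hη hφ₀.1 hv.1 (-1) ht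
  simpa [sub_eq_add_neg] using this

end

section

/-! ### Darcy flows and harmonic extensions -/

lemma Separated.sign_mul_lt {P : Phase} {η : Hor d → ℝ} {b : Rigid d} (h : Separated P η b) :
    ∀ β ∈ b, ∀ x, P.sign * β x < P.sign * η x := by
  intro β hβ x
  cases P <;> obtain ⟨h, h0, hs⟩ := h <;> have := hs β hβ x <;> simp only [Phase.sign] <;> linarith

lemma dot_smul_left (c : ℝ) (u a : Pt d) : dot (c • u) a = c * dot u a := by
  simp only [dot, Prod.smul_fst, Prod.smul_snd, real_inner_smul_left, smul_eq_mul]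
  ring

lemma DivFree.const_smul {Ω : Set (Pt d)} {w : Pt d → Pt d} (h : DivFree Ω w) (c : ℝ) :
    DivFree Ω (fun z => c • w z) := fun ψ hψ hs => by
  simp only [dot_smul_left, integral_const_mul, h ψ hψ hs, mul_zero]

variable {P : Phase} {η : Hor d → ℝ} {b : Rigid d}

lemma NoFlux.const_smul {w : Pt d → Pt d} (h : NoFlux P η b w) (c : ℝ) :
    NoFlux P η b (fun z => c • w z) := fun v wv hv ht => by
  simp only [dot_smul_left, integral_const_mul, h v wv hv ht, mul_zero]

lemma normalFlux_const_smul (c : ℝ) (w : Pt d → Pt d) (ψ : Pt d → ℝ) :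
    normalFlux P η b (fun z => c • w z) ψ = c * normalFlux P η b w ψ := by
  simp only [normalFlux, dot_smul_left, integral_const_mul]
  ring

/-- The extension selected inside `DN` may differ from the given one, but the gradients agree almost
everywhere and the flux depends on the gradient alone. -/
lemma IsHarmonicExtension.DN_eq {f : Hor d → ℝ} {φ : Pt d → ℝ} {w : Pt d → Pt d}
    (h : IsHarmonicExtension P η b f φ w) (ψ : Pt d → ℝ) :
    DN P η b f ψ = normalFlux P η b w ψ := by
  have hex : ∃ w, ∃ φ, IsHarmonicExtension P η b f φ w := ⟨w, φ, h⟩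
  obtain ⟨φ', h'⟩ := hex.choose_spec
  rw [DN, dif_pos hex, normalFlux, normalFlux]
  congr 1
  refine integral_congr_ae ?_
  filter_upwards [h'.grad_unique h] with z hz
  rw [hz]

lemma fderiv_snd_eq_dot (z a : Pt d) : fderiv ℝ (Prod.snd : Pt d → ℝ) z a = dot eVert a := by
  simp [fderiv_snd, dot, eVert]

lemma hasWeakGrad_snd (Ω : Set (Pt d)) : HasWeakGrad Ω Prod.snd (fun _ => eVert) :=
  hasWeakGrad_of_contDiff contDiff_snd continuous_const fderiv_snd_eq_dot

lemma isTrace_snd (hη : Continuous η) (hb : RigidLipschitz b) (hs : Separated P η b) :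
    IsTrace P η b Prod.snd (fun _ => eVert) η :=
  isTrace_of_contDiff hη hb hs.sign_mul_lt contDiff_snd fderiv_snd_eq_dot

/-- Adding `ρ g y` to the pressure cancels gravity in Darcy's law and leaves the gradient `-μ u`.
Finite energy, vanishing divergence and the no-flux condition are then those of `u`. -/
lemma IsDarcyFlow.isHarmonicExtension {μ ρ g : ℝ} (hη : Continuous η) (hb : RigidLipschitz b)
    (hs : Separated P η b) {u : Pt d → Pt d} {p : Pt d → ℝ} {π : Hor d → ℝ}
    (h : IsDarcyFlow P μ ρ g η b u p π) :
    IsHarmonicExtension P η b (fun x => π x + ρ * g * η x) (fun z => p z + ρ * g * z.2)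
      (fun z => (-μ) • u z) := by
  have e : (fun z => -((ρ * g) • eVert) - μ • u z + (ρ * g) • eVert) = fun z => (-μ) • u z := by
    ext1 z
    module
  have hw := h.darcy.add_const_mul (ρ * g) (hasWeakGrad_snd _)
  have ht := h.trace.add_const_mul hη h.darcy (hasWeakGrad_snd _) (ρ * g) (isTrace_snd hη hb hs)
  rw [e] at hw ht
  exact ⟨⟨hw, h.finiteEnergy.const_smul (-μ)⟩, h.divFree.const_smul _, ht,
    h.noPenetration.const_smul _⟩

/-- The inverse of the preceding correspondence: Darcy's law is solved for `u`, and the hydrostatic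
part is subtracted from the potential. The pressure gradient then contains a constant, so it need
only be locally square integrable. -/
lemma IsHarmonicExtension.isDarcyFlow {μ : ℝ} (hμ : μ ≠ 0) (ρ g : ℝ) (hη : Continuous η)
    (hb : RigidLipschitz b) (hs : Separated P η b) {f : Hor d → ℝ} {φ : Pt d → ℝ}
    {w : Pt d → Pt d} (h : IsHarmonicExtension P η b f φ w) :
    IsDarcyFlow P μ ρ g η b (fun z => (-(1 / μ)) • w z) (fun z => φ z + -(ρ * g) * z.2)
      (fun x => f x + -(ρ * g) * η x) := by
  have e : (fun z => w z + (-(ρ * g)) • eVert)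
      = fun z => -((ρ * g) • eVert) - μ • (-(1 / μ)) • w z := by
    ext1 z
    rw [smul_smul, mul_neg, mul_one_div_cancel hμ]
    module
  have hw := h.finiteEnergy.1.add_const_mul (-(ρ * g)) (hasWeakGrad_snd _)
  have ht := h.dirichlet.add_const_mul hη h.finiteEnergy.1 (hasWeakGrad_snd _) (-(ρ * g))
    (isTrace_snd hη hb hs)
  rw [e] at hw ht
  exact ⟨h.finiteEnergy.2.const_smul (-(1 / μ)), hw, h.harmonic.const_smul _, h.neumann.const_smul _, ht⟩

lemma integrable_mul_test {f : Hor d → ℝ} (hf : LocallyIntegrable f) {ψ : Hor d → ℝ}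
    (hψ : IsTest ψ) : Integrable fun x => f x * ψ x := by
  refine (hf.integrable_smul_left_of_hasCompactSupport hψ.1.continuous hψ.2).congr
    (.of_forall fun x => ?_)
  simp [mul_comm]

lemma integral_add_const_mul_mul_test {f η : Hor d → ℝ} (hf : LocallyIntegrable f)
    (hη : Continuous η) (c : ℝ) {ψ : Hor d → ℝ} (hψ : IsTest ψ) :
    ∫ x, (f x + c * η x) * ψ x = (∫ x, f x * ψ x) + c * ∫ x, η x * ψ x := by
  rw [← integral_const_mul, ← integral_add (integrable_mul_test hf hψ)
    ((integrable_mul_test hη.locallyIntegrable hψ).const_mul c)]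
  congr 1
  ext x
  ring

/-! ### Reformulation of the Muskat problems -/

/-! ### The one-phase problem. -/

section

variable {g s T μ ρ : ℝ} {η : ℝ → Hor d → ℝ}

lemma OnePhaseMuskat.onePhaseDN (hμ : 0 < μ) (hb : RigidLipschitz b)
    (hη : Admissible Phase.lower T b η) {u : ℝ → Pt d → Pt d} {p : ℝ → Pt d → ℝ}
    (h : OnePhaseMuskat μ ρ g s T b η u p) : OnePhaseDN μ ρ g s T b η := by
  obtain ⟨ηt, ht, h⟩ := h
  refine ⟨ηt, ht, ?_⟩
  filter_upwards [h, hη] with t ⟨π, hflow, hkin, hcap⟩ ⟨⟨K, hK⟩, hsep⟩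
  have hext := hflow.isHarmonicExtension hK.continuous hb hsep
  refine ⟨_, ⟨_, _, hext.finiteEnergy, hext.dirichlet⟩, fun ψ hψ => ?_, fun ψ hψ => ?_⟩
  · rw [integral_add_const_mul_mul_test hflow.trace.1 hK.continuous _ hψ, hcap ψ hψ]
  · rw [hext.DN_eq, normalFlux_const_smul, hkin ψ hψ]
    field_simp

lemma OnePhaseDN.exists_onePhaseMuskat (hμ : 0 < μ) (hb : RigidLipschitz b)
    (hη : Admissible Phase.lower T b η) (h : OnePhaseDN μ ρ g s T b η) :
    ∃ u p, OnePhaseMuskat μ ρ g s T b η u p := by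
  obtain ⟨ηt, ht, h⟩ := h
  have key : ∀ᵐ t ∂volume.restrict (Ioo 0 T), ∃ (up : (Pt d → Pt d) × (Pt d → ℝ))
      (π : Hor d → ℝ), IsDarcyFlow Phase.lower μ ρ g (η t) b up.1 up.2 π ∧
      (∀ ψ, IsTest ψ → onInterface (η t) (ηt t) ψ = normalFlux Phase.lower (η t) b up.1 ψ) ∧
      (∀ ψ, IsTest ψ → ∫ x, π x * ψ x = s * meanCurvature (η t) ψ) := by
    filter_upwards [h, hη] with t ⟨f, hf, hcap, hkin⟩ ⟨⟨K, hK⟩, hsep⟩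
    -- Being Dirichlet data only provides some finite energy function with trace `f`; existence of
    -- the variational solution replaces it by a harmonic one.
    obtain ⟨φ, w, hext⟩ := hf.exists_isHarmonicExtension hK.continuous hb hsep.sign_mul_lt
    refine ⟨(_, _), _, hext.isDarcyFlow hμ.ne' ρ g hK.continuous hb hsep, fun ψ hψ => ?_,
      fun ψ hψ => ?_⟩
    · rw [normalFlux_const_smul, hkin ψ hψ, hext.DN_eq]
    · rw [integral_add_const_mul_mul_test hext.dirichlet.1 hK.continuous _ hψ, hcap ψ hψ]
      ring
  -- Velocity and pressure are chosen independently at each time; the formulation imposes no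
  -- regularity in `t` on them.
  obtain ⟨up, hup⟩ := Filter.skolem.1 key
  exact ⟨fun t => (up t).1, fun t => (up t).2, ηt, ht, hup⟩

end

/-! ### The two-phase problem. -/

section

variable {g s T μm μp ρm ρp : ℝ} {bm bp : Rigid d} {η : ℝ → Hor d → ℝ}

lemma TwoPhaseMuskat.exists_twoPhaseDN (hμm : 0 < μm) (hμp : 0 < μp) (hbm : RigidLipschitz bm)
    (hbp : RigidLipschitz bp) (hηm : Admissible Phase.lower T bm η)
    (hηp : Admissible Phase.upper T bp η) {um up : ℝ → Pt d → Pt d} {pm pp : ℝ → Pt d → ℝ}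
    (h : TwoPhaseMuskat μm μp ρm ρp g s T bm bp η um up pm pp) :
    ∃ fm fp, IsModifiedTrace Phase.lower μm ρm g T bm η um pm fm ∧
      IsModifiedTrace Phase.upper μp ρp g T bp η up pp fp ∧
      TwoPhaseDN μm μp ρm ρp g s T bm bp η fm fp := by
  obtain ⟨ηt, ht, h⟩ := h
  -- The pressure traces are only known to exist at each time separately. Pairing them allows a
  -- single choice in `t`, which is needed because `fm` and `fp` must be functions of time.
  have key := h.mono fun t h => (⟨(h.choose, h.choose_spec.choose), h.choose_spec.choose_spec⟩ :
    ∃ π : (Hor d → ℝ) × (Hor d → ℝ),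
      IsDarcyFlow Phase.lower μm ρm g (η t) bm (um t) (pm t) π.1 ∧
      IsDarcyFlow Phase.upper μp ρp g (η t) bp (up t) (pp t) π.2 ∧
      (∀ ψ, IsTest ψ → normalFlux Phase.upper (η t) bp (up t) ψ
        = normalFlux Phase.lower (η t) bm (um t) ψ) ∧
      (∀ ψ, IsTest ψ → onInterface (η t) (ηt t) ψ = normalFlux Phase.lower (η t) bm (um t) ψ) ∧
      (∀ ψ, IsTest ψ → ∫ x, (π.1 x - π.2 x) * ψ x = s * meanCurvature (η t) ψ))
  obtain ⟨π, hπ⟩ := Filter.skolem.1 key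
  refine ⟨fun t x => (π t).1 x + ρm * g * η t x, fun t x => (π t).2 x + ρp * g * η t x,
    hπ.mono fun t h => ⟨_, h.1.trace, fun x => rfl⟩,
    hπ.mono fun t h => ⟨_, h.2.1.trace, fun x => rfl⟩, ηt, ht, ?_⟩
  filter_upwards [hπ, hηm, hηp] with t ⟨hm, hp, hflux, hkin, hcap⟩ ⟨⟨K, hK⟩, hsm⟩ ⟨_, hsp⟩
  have em := hm.isHarmonicExtension hK.continuous hbm hsm
  have ep := hp.isHarmonicExtension hK.continuous hbp hsp
  refine ⟨⟨_, _, em.finiteEnergy, em.dirichlet⟩, ⟨_, _, ep.finiteEnergy, ep.dirichlet⟩,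
    fun ψ hψ => ?_, fun ψ hψ => ?_, fun ψ hψ => ?_⟩
  · rw [← hcap ψ hψ]
    refine Eq.trans ?_ (integral_add_const_mul_mul_test (hm.trace.1.sub hp.trace.1) hK.continuous
      ((ρm - ρp) * g) hψ)
    congr 1
    ext x
    simp only [Pi.sub_apply]
    ring
  -- The extensions have gradients `-μm u⁻` and `-μp u⁺`, so after division by the viscosities the
  -- two terms are minus the normal fluxes, which agree.
  · rw [em.DN_eq, ep.DN_eq, normalFlux_const_smul, normalFlux_const_smul, hflux ψ hψ]
    field_simp
    ring
  · rw [em.DN_eq, normalFlux_const_smul, hkin ψ hψ]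
    field_simp

lemma TwoPhaseDN.exists_twoPhaseMuskat (hμm : 0 < μm) (hμp : 0 < μp) (hbm : RigidLipschitz bm)
    (hbp : RigidLipschitz bp) (hηm : Admissible Phase.lower T bm η)
    (hηp : Admissible Phase.upper T bp η) {fm fp : ℝ → Hor d → ℝ}
    (h : TwoPhaseDN μm μp ρm ρp g s T bm bp η fm fp) :
    ∃ um up pm pp, TwoPhaseMuskat μm μp ρm ρp g s T bm bp η um up pm pp := by
  obtain ⟨ηt, ht, h⟩ := h
  have key : ∀ᵐ t ∂volume.restrict (Ioo 0 T),
      ∃ q : ((Pt d → Pt d) × (Pt d → Pt d)) × (Pt d → ℝ) × (Pt d → ℝ), ∃ πm πp : Hor d → ℝ,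
      IsDarcyFlow Phase.lower μm ρm g (η t) bm q.1.1 q.2.1 πm ∧
      IsDarcyFlow Phase.upper μp ρp g (η t) bp q.1.2 q.2.2 πp ∧
      (∀ ψ, IsTest ψ → normalFlux Phase.upper (η t) bp q.1.2 ψ
        = normalFlux Phase.lower (η t) bm q.1.1 ψ) ∧
      (∀ ψ, IsTest ψ → onInterface (η t) (ηt t) ψ = normalFlux Phase.lower (η t) bm q.1.1 ψ) ∧
      (∀ ψ, IsTest ψ → ∫ x, (πm x - πp x) * ψ x = s * meanCurvature (η t) ψ) := by
    filter_upwards [h, hηm, hηp] with t ⟨hm, hp, hcap, hflux, hkin⟩ ⟨⟨K, hK⟩, hsm⟩ ⟨_, hsp⟩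
    obtain ⟨φm, wm, em⟩ := hm.exists_isHarmonicExtension hK.continuous hbm hsm.sign_mul_lt
    obtain ⟨φp, wp, ep⟩ := hp.exists_isHarmonicExtension hK.continuous hbp hsp.sign_mul_lt
    refine ⟨((_, _), (_, _)), _, _, em.isDarcyFlow hμm.ne' ρm g hK.continuous hbm hsm,
      ep.isDarcyFlow hμp.ne' ρp g hK.continuous hbp hsp, fun ψ hψ => ?_, fun ψ hψ => ?_,
      fun ψ hψ => ?_⟩
    · have := hflux ψ hψ
      rw [em.DN_eq, ep.DN_eq] at this
      rw [normalFlux_const_smul, normalFlux_const_smul]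
      linarith
    · rw [normalFlux_const_smul, hkin ψ hψ, em.DN_eq]
    -- Passing from `f^±` back to the pressure traces subtracts `(ρm - ρp) g η` from the jump, which
    -- leaves the curvature term alone.
    · have h1 := integral_add_const_mul_mul_test (em.dirichlet.1.sub ep.dirichlet.1) hK.continuous
        (-((ρm - ρp) * g)) hψ
      simp only [Pi.sub_apply] at h1
      rw [hcap ψ hψ] at h1
      have h2 : s * meanCurvature (η t) ψ = s * meanCurvature (η t) ψ
          + (ρm - ρp) * g * (∫ x, η t x * ψ x) + -((ρm - ρp) * g) * ∫ x, η t x * ψ x := by ring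
      rw [h2, ← h1]
      congr 1
      ext x
      ring
  obtain ⟨q, hq⟩ := Filter.skolem.1 key
  exact ⟨fun t => (q t).1.1, fun t => (q t).1.2, fun t => (q t).2.1, fun t => (q t).2.2, ηt, ht, hq⟩

end

end

end Muskat

end

open Muskat in
theorem proposition1p1 (d : ℕ) (hd : 1 ≤ d) (g s T : ℝ) (hs : 0 ≤ s) (hT : 0 < T) :
    -- (i) one-phase problem
    (∀ (μ ρ : ℝ) (b : Rigid d) (η : ℝ → Hor d → ℝ), 0 < μ → RigidLipschitz b →
      Admissible Phase.lower T b η →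
        (∀ u p, OnePhaseMuskat μ ρ g s T b η u p → OnePhaseDN μ ρ g s T b η) ∧
        (OnePhaseDN μ ρ g s T b η → ∃ u p, OnePhaseMuskat μ ρ g s T b η u p)) ∧
    -- (ii) two-phase problem
    (∀ (μm μp ρm ρp : ℝ) (bm bp : Rigid d) (η : ℝ → Hor d → ℝ), 0 < μm → 0 < μp →
      RigidLipschitz bm → RigidLipschitz bp →
      Admissible Phase.lower T bm η → Admissible Phase.upper T bp η →
        (∀ um up pm pp, TwoPhaseMuskat μm μp ρm ρp g s T bm bp η um up pm pp →
          ∃ fm fp, IsModifiedTrace Phase.lower μm ρm g T bm η um pm fm ∧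
            IsModifiedTrace Phase.upper μp ρp g T bp η up pp fp ∧
            TwoPhaseDN μm μp ρm ρp g s T bm bp η fm fp) ∧
        (∀ fm fp, TwoPhaseDN μm μp ρm ρp g s T bm bp η fm fp →
          ∃ um up pm pp, TwoPhaseMuskat μm μp ρm ρp g s T bm bp η um up pm pp)) := by
  exact ⟨fun μ ρ b η hμ hb hη => ⟨fun u p h => h.onePhaseDN hμ hb hη,
      fun h => h.exists_onePhaseMuskat hμ hb hη⟩,
    fun μm μp ρm ρp bm bp η hμm hμp hbm hbp hηm hηp =>
      ⟨fun um up pm pp h => h.exists_twoPhaseDN hμm hμp hbm hbp hηm hηp,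
        fun fm fp h => h.exists_twoPhaseMuskat hμm hμp hbm hbp hηm hηp⟩⟩
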